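/- Let $G$ be a locally finite tree with root $\rho$, let $p\in(0,1)$ and $q:=1-p$, and consider dynamical percolation with parameter $p$ on $G$: at time $0$ the edges are independently open with probability $p$ and closed with probability $q$, and afterwards the edges evolve independently of one another, each as a two-state continuous-time Markov chain with right-continuous paths having left limits that flips from closed to open at rate $p$ and from open to closed at rate $q$ (so that each edge is stationary). Let $\mathrm P_p$ be the underlying probability measure, and for $t\ge 0$ let $\{\rho\stackrel{t}{\leftrightarrow}\infty\}$ be the event that at time $t$ the connected cluster of open edges containing $\rho$ is infinite. Let $\partial G$ be the set of infinite self-avoiding paths (rays) in $G$ starting at $\rho$, with the metric $d(v,w):=\exp(-|v\wedge w|)$, where $|v\wedge w|\in\{0,1,2,\dots,\infty\}$ is the height (distance from $\rho$) of the last common vertex of $v$ and $w$ ($|v\wedge v|:=\infty$ and $e^{-\infty}:=0$). For $v,w\in\partial G$ and $s,t\ge 0$ put $$h\big((v,s);(w,t)\big):=\Big(1+\frac qp\,e^{-|s-t|}\Big)^{|v\wedge w|}\in[1,\infty],$$ and for Borel sets $F\subseteq\partial G\times[0,\infty)$ put $$\mathrm{Cap}_h(F):=\Big[\inf_{\mu\in\mathcal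 P(F)}\iint h(x;y)\,\mu(dx)\,\mu(dy)\Big]^{-1},$$ where $\mathcal P(F)$ is the set of all Borel probability measures on $F$, $\inf\varnothing:=\infty$ and $1/\infty:=0$. Then, for every compact set $D\subseteq[0,\infty)$, $$\mathrm P_p\Big(\bigcup_{t\in D}\{\rho\stackrel{t}{\leftrightarrow}\infty\}\Big)>0\quad\text{if and only if}\quad \mathrm{Cap}_h(\partial G\times D)>0.$$ -/

import Mathlib

open Set Filter Topology MeasureTheory ProbabilityTheory
open scoped NNReal ENNReal

namespace DynPerc

noncomputable section

/-! ### Energy and capacity -/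

/-- The `f`-energy `∬ f(x, y) μ(dx) μ(dy)` of a measure `μ`. -/
def energy {S : Type*} [MeasurableSpace S] (f : S → S → ℝ≥0∞) (μ : Measure S) : ℝ≥0∞ :=
  ∫⁻ x, ∫⁻ y, f x y ∂μ ∂μ

/-- The `f`-capacity of `F`: the inverse of the infimum of the `f`-energy over all probability
measures carried by `F`, with the conventions `inf ∅ = ∞`, `1 / ∞ = 0`. -/
def capacity {S : Type*} [MeasurableSpace S] (f : S → S → ℝ≥0∞) (F : Set S) : ℝ≥0∞ :=
  (⨅ (μ : Measure S) (_ : IsProbabilityMeasure μ) (_ : μ Fᶜ = 0), energy f μ)⁻¹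

/-! ### The boundary of a rooted graph -/

/-- The boundary of the tree `G` rooted at `ρ`: the infinite self-avoiding paths from `ρ`. -/
@[ext]
structure Boundary {V : Type*} (G : SimpleGraph V) (ρ : V) where
  /-- the vertex of height `n` on the ray -/
  vertex : ℕ → V
  start : vertex 0 = ρ
  adj : ∀ n, G.Adj (vertex n) (vertex (n + 1))
  injective : Function.Injective vertex

namespace Boundary

variable {V : Type*} {G : SimpleGraph V} {ρ : V}

/-- `|v ∧ w|`: the height of the last common vertex of the rays `v` and `w`; it is `∞` when
`v = w`. -/
def meetHeight (v w : Boundary G ρ) : ℕ∞ :=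
  ⨆ (n : ℕ) (_ : ∀ k ≤ n, v.vertex k = w.vertex k), (n : ℕ∞)

theorem le_meetHeight_iff (v w : Boundary G ρ) (n : ℕ) :
    (n : ℕ∞) ≤ meetHeight v w ↔ ∀ k ≤ n, v.vertex k = w.vertex k := by
  constructor
  · intro h k hk
    by_contra hne
    have hk0 : k ≠ 0 := by
      rintro rfl
      exact hne (v.start.trans w.start.symm)
    have h2 : meetHeight v w ≤ ((k - 1 : ℕ) : ℕ∞) := by
      refine iSup₂_le fun m hm => ?_
      have : m < k := by
        by_contra hmk
        exact hne (hm k (by omega))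
      exact_mod_cast (by omega : m ≤ k - 1)
    have h3 : n ≤ k - 1 := by exact_mod_cast h.trans h2
    omega
  · intro h
    exact le_iSup₂_of_le n h le_rfl

theorem meetHeight_eq_top_iff (v w : Boundary G ρ) : meetHeight v w = ⊤ ↔ v = w := by
  constructor
  · intro h
    ext n
    exact (le_meetHeight_iff v w n).1 (h ▸ le_top) n le_rfl
  · rintro rfl
    exact ENat.eq_top_iff_forall_ge.2 fun n => (le_meetHeight_iff v v n).2 fun _ _ => rfl

theorem meetHeight_comm (v w : Boundary G ρ) : meetHeight v w = meetHeight w v := by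
  simp only [meetHeight, eq_comm]

theorem min_meetHeight_le (u v w : Boundary G ρ) :
    min (meetHeight u v) (meetHeight v w) ≤ meetHeight u w := by
  refine ENat.forall_natCast_le_iff_le.1 fun n hn => ?_
  rw [le_min_iff, le_meetHeight_iff, le_meetHeight_iff] at hn
  exact (le_meetHeight_iff u w n).2 fun k hk => (hn.1 k hk).trans (hn.2 k hk)

/-- `exp (-k)` for `k ∈ {0, 1, 2, …, ∞}`. -/
def expNeg (k : ℕ∞) : ℝ := if k = ⊤ then 0 else Real.exp (-(k.toNat : ℝ))

theorem expNeg_nonneg (k : ℕ∞) : 0 ≤ expNeg k := by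
  unfold expNeg
  split_ifs
  · exact le_rfl
  · exact (Real.exp_pos _).le

theorem expNeg_anti {k l : ℕ∞} (h : k ≤ l) : expNeg l ≤ expNeg k := by
  by_cases hl : l = ⊤
  · rw [expNeg, if_pos hl]
    exact expNeg_nonneg k
  · have hk : k ≠ ⊤ := ne_top_of_le_ne_top hl h
    rw [expNeg, expNeg, if_neg hl, if_neg hk, Real.exp_le_exp, neg_le_neg_iff, Nat.cast_le]
    exact ENat.toNat_le_toNat h hl

/-- The boundary carries the metric `d(v, w) = exp (-|v ∧ w|)`. -/
instance : MetricSpace (Boundary G ρ) where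
  dist v w := expNeg (meetHeight v w)
  dist_self v := by simp [expNeg, (meetHeight_eq_top_iff v v).2 rfl]
  dist_comm v w := by rw [meetHeight_comm]
  dist_triangle u v w := by
    rcases min_le_iff.1 (min_meetHeight_le u v w) with h | h
    · exact (expNeg_anti h).trans (le_add_of_nonneg_right (expNeg_nonneg _))
    · exact (expNeg_anti h).trans (le_add_of_nonneg_left (expNeg_nonneg _))
  eq_of_dist_eq_zero := by
    intro v w h
    by_contra hne
    rw [expNeg, if_neg (mt (meetHeight_eq_top_iff v w).1 hne)] at h
    exact (Real.exp_pos _).ne' h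

instance : MeasurableSpace (Boundary G ρ) := borel _

instance : BorelSpace (Boundary G ρ) := ⟨rfl⟩

end Boundary

/-- The kernel `h((v, s), (w, t)) = (1 + (q / p) exp (-|s - t|)) ^ |v ∧ w|`, where `q = 1 - p`. The
base is larger than `1`, so the value is `∞` when `|v ∧ w| = ∞`. -/
def kernelH {V : Type*} {G : SimpleGraph V} {ρ : V} (p : ℝ)
    (x y : Boundary G ρ × ℝ≥0) : ℝ≥0∞ :=
  if Boundary.meetHeight x.1 y.1 = ⊤ then ⊤
  else ENNReal.ofReal (1 + (1 - p) / p * Real.exp (-|(x.2 : ℝ) - (y.2 : ℝ)|)) ^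
    (Boundary.meetHeight x.1 y.1).toNat

/-! ### Dynamical percolation

The state of an edge is a Boolean: `true` means open, `false` means closed. -/

/-- The law of the state of an edge at a fixed time: open with probability `p`. -/
def edgeProb (p : ℝ) : Bool → ℝ
  | true => p
  | false => 1 - p

/-- The infinitesimal generator: a closed edge opens at rate `p`, an open edge closes at rate
`q = 1 - p`. -/
def rateMatrix (p : ℝ) : Matrix Bool Bool ℝ :=
  Matrix.of fun
    | false, false => -p
    | false, true => p
    | true, false => 1 - p
    | true, true => -(1 - p)

/-- The transition probabilities `exp (t Q)` of the two-state Markov chain with generator `Q`. -/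
def transition (p t : ℝ) : Matrix Bool Bool ℝ := NormedSpace.exp (t • rateMatrix p)

/-- The transition probabilities in closed form. -/
theorem transition_apply (p t : ℝ) (i j : Bool) :
    transition p t i j =
      edgeProb p j + Real.exp (-t) * ((if i = j then 1 else 0) - edgeProb p j) := by
  let U : Matrix Bool Bool ℝ := Matrix.of fun
    | false, false => 1
    | false, true => p
    | true, false => 1
    | true, true => -(1 - p)
  let W : Matrix Bool Bool ℝ := Matrix.of fun
    | false, false => 1 - p
    | false, true => p
    | true, false => 1
    | true, true => -1
  have hUW : U * W = 1 := by
    ext i j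
    cases i <;> cases j <;> simp [U, W, Matrix.mul_apply] <;> ring
  have hWU : W * U = 1 := by
    ext i j
    cases i <;> cases j <;> simp [U, W, Matrix.mul_apply] <;> ring
  let u : (Matrix Bool Bool ℝ)ˣ := ⟨U, W, hUW, hWU⟩
  let d : Bool → ℝ := fun i => if i then -t else 0
  have hQ : t • rateMatrix p = (u : Matrix Bool Bool ℝ) * Matrix.diagonal d *
      ((u⁻¹ : (Matrix Bool Bool ℝ)ˣ) : Matrix Bool Bool ℝ) := by
    change t • rateMatrix p = U * Matrix.diagonal d * W
    ext i j
    cases i <;> cases j <;>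
      simp [U, W, d, rateMatrix, Matrix.mul_apply, Matrix.diagonal_apply] <;> ring
  rw [transition, hQ, Matrix.exp_units_conj, Matrix.exp_diagonal]
  change (U * Matrix.diagonal (NormedSpace.exp d) * W) i j = _
  have hd : ∀ i, (NormedSpace.exp d) i = Real.exp (d i) := by
    intro i
    rw [Pi.coe_exp, Real.exp_eq_exp_ℝ]
  cases i <;> cases j <;>
    simp [U, W, d, edgeProb, Matrix.mul_apply, Matrix.diagonal_apply, hd] <;> ring

/-- `Y` is a stationary continuous-time Markov chain on `{open, closed}` with the flip rates above,
given by its finite-dimensional distributions. -/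
def IsStationaryEdgeChain {Ω : Type*} [MeasurableSpace Ω] (P : Measure Ω) (p : ℝ)
    (Y : ℝ≥0 → Ω → Bool) : Prop :=
  (∀ t, Measurable (Y t)) ∧
  ∀ (n : ℕ) (t : Fin (n + 1) → ℝ≥0), Monotone t → ∀ x : Fin (n + 1) → Bool,
    P {ω | ∀ i, Y (t i) ω = x i} =
      ENNReal.ofReal (edgeProb p (x 0) *
        ∏ i : Fin n, transition p ((t i.succ : ℝ) - (t i.castSucc : ℝ)) (x i.castSucc) (x i.succ))

/-- A path in a topological space is càdlàg: right-continuous with left limits. -/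
def IsCadlagPath {E : Type*} [TopologicalSpace E] (y : ℝ≥0 → E) : Prop :=
  ∀ t, ContinuousWithinAt y (Ici t) t ∧ ∃ l, Tendsto y (𝓝[<] t) (𝓝 l)

/-- `X` is dynamical percolation with parameter `p` on the edges of `G`: the edges evolve
independently of each other, each of them as a stationary Markov chain that opens at rate `p` and
closes at rate `1 - p`, and almost surely all paths are càdlàg. -/
structure IsDynamicalPercolation {V Ω : Type*} [MeasurableSpace Ω] (G : SimpleGraph V) (p : ℝ)
    (P : Measure Ω) (X : G.edgeSet → ℝ≥0 → Ω → Bool) : Prop where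
  chain : ∀ e, IsStationaryEdgeChain P p (X e)
  indep : iIndepFun (fun (e : G.edgeSet) (ω : Ω) (t : ℝ≥0) => X e t ω) P
  cadlag : ∀ᵐ ω ∂P, ∀ e, IsCadlagPath fun t => X e t ω

/-- The subgraph of open edges in a given configuration. -/
def openGraph {V : Type*} (G : SimpleGraph V) (x : G.edgeSet → Bool) : SimpleGraph V :=
  SimpleGraph.fromEdgeSet {e | ∃ he : e ∈ G.edgeSet, x ⟨e, he⟩ = true}

/-- `ρ ↔ ∞`: the connected cluster of open edges emanating from `ρ` is infinite. -/
def Percolates {V : Type*} (G : SimpleGraph V) (ρ : V) (x : G.edgeSet → Bool) : Prop :=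
  {v | (openGraph G x).Reachable ρ v}.Infinite

end

end DynPerc

/-! An edge is open at both times `s` and `t` with probability `p ^ 2 * openRatio p s t`. Edges are
independent, so the kernel `h` cut off at height `n` is the correlation of the indicators,
normalized to mean one, that the first `n` edges of `v` are open at time `s` and those of `w` at
time `t`. For weights `a` on finitely many (ray, time) pairs, the energy of `a` is thus the second
moment of the weighted sum `Z` of these indicators (`IsPathLaw.sum_sq_eq_sysEnergy`). Both
directions estimate, at level `n`, the probability of the hitting event that some pair is open.

Hitting is likely if the energy is small: `Z` has mean one and vanishes off the hitting event, so
Cauchy–Schwarz applies (`IsPathLaw.one_le_hitWeight_mul`).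

Conversely, let `a` be the law of some open pair, chosen arbitrarily, given that one exists
(`IsPathLaw.exists_energy_le`). Order the rays lexicographically, so that rays with a common initial
segment form an interval. If the pair `(i, j)` is open, then conditioning `Z` first on the edges of
the rays up to `i`, then on the states up to time `j`, leaves at least the part of the potential of
`a` at `(i, j)` that comes from the quadrant of later rays and times. The dual Doob inequality, once
per parameter, bounds the sum of these contributions against the chosen pair. Four quadrants cover
everything; the two with reversed time rely on reversibility of the chain.

To pass from levels to infinity in the direction percolation ⇒ capacity, right-continuity reduces
`D` to finitely many times at each level. The measures so obtained have a weak limit on the compact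
space `∂G × D`, and the truncated kernels are continuous and increase to `h`
(`IsDynamicalPercolation.capacity_pos`).

For capacity ⇒ percolation, a measure of finite energy is discretized at the cost of a factor 3.
With positive probability every level is then reached at some time in `D`. The times accumulate at
some `t ∈ D`, and percolation at `t` can fail only if they approach from the left and an edge flips
exactly at `t`. If percolation at a fixed time of `D` has probability zero, such flips almost surely
do not occur, because an edge flips independently of all others
(`IsDynamicalPercolation.measure_flipPerc`); otherwise nothing remains to be shown. -/

namespace DynPerc

/-! ### Conditional expectations on a finite weighted set and the dual Doob inequality. -/

section CondAvg

variable {C : Type*} [Fintype C]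

open Classical in
/-- The conditional expectation of `f` given the class of `R`, for the weights `W`. -/
noncomputable def condAvg (W : C → ℝ) (R : Setoid C) (f : C → ℝ) (c : C) : ℝ :=
  (∑ c', if R c c' then W c' * f c' else 0) / ∑ c', if R c c' then W c' else 0

theorem condAvg_add (W : C → ℝ) (R : Setoid C) (f g : C → ℝ) (c : C) :
    condAvg W R (fun c => f c + g c) c = condAvg W R f c + condAvg W R g c := by
  classical
  rw [condAvg, condAvg, condAvg, ← add_div, ← Finset.sum_add_distrib]
  congr 1
  refine Finset.sum_congr rfl fun c' _ => ?_
  split_ifs <;> ring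

theorem condAvg_sum {I : Type*} (s : Finset I) (W : C → ℝ) (R : Setoid C) (f : I → C → ℝ) (c : C) :
    condAvg W R (fun c => ∑ i ∈ s, f i c) c = ∑ i ∈ s, condAvg W R (f i) c := by
  classical
  induction s using Finset.induction_on with
  | empty => simp [condAvg]
  | insert i s hi ih =>
    simp only [Finset.sum_insert hi]
    rw [condAvg_add, ih]

theorem condAvg_const_mul (W : C → ℝ) (R : Setoid C) (a : ℝ) (f : C → ℝ) (c : C) :
    condAvg W R (fun c => a * f c) c = a * condAvg W R f c := by
  classical
  rw [condAvg, condAvg, ← mul_div_assoc, Finset.mul_sum]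
  congr 1
  refine Finset.sum_congr rfl fun c' _ => ?_
  split_ifs <;> ring

theorem condAvg_mono {W : C → ℝ} (hW : ∀ c, 0 ≤ W c) (R : Setoid C) {f g : C → ℝ}
    (h : ∀ c, W c ≠ 0 → f c ≤ g c) (c : C) : condAvg W R f c ≤ condAvg W R g c := by
  classical
  rw [condAvg, condAvg]
  refine div_le_div_of_nonneg_right (Finset.sum_le_sum fun c' _ => ?_)
    (Finset.sum_nonneg fun c' _ => by split_ifs <;> simp [hW])
  split_ifs
  · by_cases h0 : W c' = 0
    · simp [h0]
    · exact mul_le_mul_of_nonneg_left (h c' h0) (hW c')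
  · exact le_rfl

theorem condAvg_nonneg {W : C → ℝ} (hW : ∀ c, 0 ≤ W c) (R : Setoid C) {f : C → ℝ}
    (h : ∀ c, 0 ≤ f c) (c : C) : 0 ≤ condAvg W R f c := by
  have := condAvg_mono hW R (f := fun _ => 0) (g := f) (fun c _ => h c) c
  simpa [condAvg] using this

theorem condAvg_congr {W : C → ℝ} (hW : ∀ c, 0 ≤ W c) (R : Setoid C) {f g : C → ℝ}
    (h : ∀ c, W c ≠ 0 → f c = g c) (c : C) : condAvg W R f c = condAvg W R g c :=
  (condAvg_mono hW R (fun c hc => (h c hc).le) c).antisymm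
    (condAvg_mono hW R (fun c hc => (h c hc).ge) c)

theorem condAvg_eq_of_rel (W : C → ℝ) (R : Setoid C) (f : C → ℝ) {c d : C} (h : R c d) :
    condAvg W R f c = condAvg W R f d := by
  classical
  have : ∀ x, R c x ↔ R d x := fun x => ⟨fun hx => R.trans (R.symm h) hx, fun hx => R.trans h hx⟩
  simp only [condAvg, this]

theorem classWeight_pos {W : C → ℝ} (hW : ∀ c, 0 ≤ W c) (R : Setoid C) {c : C} (hc : W c ≠ 0)
    [DecidableRel (R : C → C → Prop)] :
    0 < ∑ c', if R c c' then W c' else 0 := by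
  have h1 : W c ≤ ∑ c', if R c c' then W c' else 0 := by
    refine le_trans ?_ (Finset.single_le_sum (fun c' _ => ?_) (Finset.mem_univ c))
    · simp
    · split_ifs <;> simp [hW]
  exact lt_of_lt_of_le (lt_of_le_of_ne (hW c) hc.symm) h1

/-- Conditional expectation fixes invariant functions. -/
theorem condAvg_of_invariant {W : C → ℝ} (hW : ∀ c, 0 ≤ W c) (R : Setoid C) {u : C → ℝ}
    (hu : ∀ c d, R c d → u c = u d) {c : C} (hc : W c ≠ 0) : condAvg W R u c = u c := by
  classical
  rw [condAvg, div_eq_iff (classWeight_pos hW R hc).ne', Finset.mul_sum]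
  refine Finset.sum_congr rfl fun c' _ => ?_
  split_ifs with h
  · rw [hu c c' h, mul_comm]
  · simp

/-- Conditional expectation is self-adjoint. -/
theorem sum_mul_condAvg_comm (W : C → ℝ) (R : Setoid C) (f g : C → ℝ) :
    ∑ c, W c * (g c * condAvg W R f c) = ∑ c, W c * (condAvg W R g c * f c) := by
  classical
  have key : ∀ f g : C → ℝ, ∑ c, W c * (g c * condAvg W R f c) =
      ∑ c, ∑ c', if R c c' then W c * g c * (W c' * f c') / (∑ x, if R c x then W x else 0)
        else 0 := by
    intro f g
    refine Finset.sum_congr rfl fun c _ => ?_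
    rw [condAvg, ← mul_assoc, ← mul_div_assoc, Finset.mul_sum, Finset.sum_div]
    refine Finset.sum_congr rfl fun c' _ => ?_
    split_ifs <;> simp
  have h2 : ∑ c, W c * (condAvg W R g c * f c) = ∑ c, W c * (f c * condAvg W R g c) :=
    Finset.sum_congr rfl fun c _ => by ring
  rw [h2, key, key, Finset.sum_comm]
  refine Finset.sum_congr rfl fun c _ => Finset.sum_congr rfl fun c' _ => ?_
  have hs : R c' c ↔ R c c' := ⟨R.symm, R.symm⟩
  simp only [hs]
  split_ifs with h
  · have : ∀ x, R c' x ↔ R c x :=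
      fun x => ⟨fun hx => R.trans h hx, fun hx => R.trans (R.symm h) hx⟩
    simp only [this]
    ring
  · rfl

/-- The dual form of Doob's `L²` maximal inequality, for a filtration indexed by a finite totally
preordered set. -/
theorem sum_sq_sum_condAvg_le {I : Type*} [Fintype I] {W : C → ℝ} (hW : ∀ c, 0 ≤ W c)
    {r : I → I → Prop} (tot : ∀ i j, r i j ∨ r j i) {R : I → Setoid C}
    (hR : ∀ i j, r i j → R j ≤ R i) {f : I → C → ℝ} (hf : ∀ i c, 0 ≤ f i c) :
    ∑ c, W c * (∑ i, condAvg W (R i) (f i) c) ^ 2 ≤ 4 * ∑ c, W c * (∑ i, f i c) ^ 2 := by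
  classical
  set S : C → ℝ := fun c => ∑ i, condAvg W (R i) (f i) c with hS
  set F : C → ℝ := fun c => ∑ i, f i c with hF
  have hE : ∀ i c, 0 ≤ condAvg W (R i) (f i) c := fun i c => condAvg_nonneg hW _ (hf i) c
  let G : I → I → ℝ := fun i j => ∑ c, W c * (condAvg W (R i) (f i) c * condAvg W (R j) (f j) c)
  have hG0 : ∀ i j, 0 ≤ G i j := fun i j =>
    Finset.sum_nonneg fun c _ => mul_nonneg (hW c) (mul_nonneg (hE i c) (hE j c))
  have hGs : ∀ i j, G i j = G j i := fun i j => Finset.sum_congr rfl fun c _ => by ring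
  have hSS : ∑ c, W c * S c ^ 2 = ∑ i, ∑ j, G i j := by
    simp only [G, hS]
    simp_rw [sq, Finset.sum_mul_sum, Finset.mul_sum]
    rw [Finset.sum_comm]
    refine Finset.sum_congr rfl fun i _ => ?_
    rw [Finset.sum_comm]
  -- By symmetry of `G` and totality of `r`, the ordered pairs carry at least half of the double
  -- sum.
  have hle : ∑ i, ∑ j, G i j ≤ 2 * ∑ i, ∑ j, if r i j then G i j else 0 := by
    have h1 : ∑ i, ∑ j, G i j ≤
        ∑ i, ∑ j, ((if r i j then G i j else 0) + if r j i then G j i else 0) := by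
      refine Finset.sum_le_sum fun i _ => Finset.sum_le_sum fun j _ => ?_
      rcases tot i j with h | h
      · rw [if_pos h]
        refine le_add_of_nonneg_right ?_
        split_ifs <;> simp [hG0]
      · rw [if_pos h, hGs i j]
        refine le_add_of_nonneg_left ?_
        split_ifs <;> simp [hG0]
    refine h1.trans_eq ?_
    simp_rw [Finset.sum_add_distrib]
    rw [two_mul]
    congr 1
    exact Finset.sum_comm
  -- The average over the coarser `R i` is already invariant under `R j`, so by self-adjointness the
  -- average over `R j` can be dropped.
  have hG : ∀ i j, r i j → G i j = ∑ c, W c * (condAvg W (R i) (f i) c * f j c) := by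
    intro i j hij
    simp only [G]
    rw [sum_mul_condAvg_comm]
    refine Finset.sum_congr rfl fun c _ => ?_
    by_cases hc : W c = 0
    · simp [hc]
    · rw [condAvg_of_invariant hW (R j) _ hc]
      exact fun c d h => condAvg_eq_of_rel W (R i) (f i) (hR i j hij h)
  have hSF : ∑ i, ∑ j, (if r i j then G i j else 0) ≤ ∑ c, W c * (S c * F c) := by
    have h1 : ∑ c, W c * (S c * F c) =
        ∑ i, ∑ j, ∑ c, W c * (condAvg W (R i) (f i) c * f j c) := by
      simp only [hS, hF]
      simp_rw [Finset.sum_mul_sum, Finset.mul_sum]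
      rw [Finset.sum_comm]
      refine Finset.sum_congr rfl fun i _ => ?_
      rw [Finset.sum_comm]
    rw [h1]
    refine Finset.sum_le_sum fun i _ => Finset.sum_le_sum fun j _ => ?_
    split_ifs with h
    · rw [hG i j h]
    · exact Finset.sum_nonneg fun c _ => mul_nonneg (hW c) (mul_nonneg (hE i c) (hf j c))
  -- The coefficient `1 / 2` is chosen so that half of the left side of the claim can be absorbed,
  -- which leaves the constant 4.
  have hYoung : 2 * ∑ c, W c * (S c * F c) ≤
      (1 / 2) * ∑ c, W c * S c ^ 2 + 2 * ∑ c, W c * F c ^ 2 := by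
    simp_rw [Finset.mul_sum, ← Finset.sum_add_distrib]
    refine Finset.sum_le_sum fun c _ => ?_
    nlinarith [mul_nonneg (hW c) (sq_nonneg (S c - 2 * F c))]
  change ∑ c, W c * S c ^ 2 ≤ 4 * ∑ c, W c * F c ^ 2
  linarith

/-- The two-parameter version of `sum_sq_sum_condAvg_le`, integrated against `Z`. -/
theorem sq_sum_condAvg_condAvg_le {I J : Type*} [Fintype I] [Fintype J] {W : C → ℝ}
    (hW : ∀ c, 0 ≤ W c) {r : I → I → Prop} (rtot : ∀ i j, r i j ∨ r j i) {R : I → Setoid C}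
    (hR : ∀ i j, r i j → R j ≤ R i) {q : J → J → Prop} (qtot : ∀ i j, q i j ∨ q j i)
    {S : J → Setoid C} (hS : ∀ i j, q i j → S j ≤ S i) {f : I → J → C → ℝ}
    (hf : ∀ i j c, 0 ≤ f i j c) (Z : C → ℝ) :
    (∑ i, ∑ j, ∑ c, W c * (condAvg W (S j) (condAvg W (R i) Z) c * f i j c)) ^ 2 ≤
      16 * (∑ c, W c * Z c ^ 2) * ∑ c, W c * (∑ i, ∑ j, f i j c) ^ 2 := by
  set T : C → ℝ := fun c => ∑ i, condAvg W (R i) (fun c => ∑ j, condAvg W (S j) (f i j) c) c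
  have hZT : ∑ i, ∑ j, ∑ c, W c * (condAvg W (S j) (condAvg W (R i) Z) c * f i j c) =
      ∑ c, W c * (Z c * T c) := by
    simp only [T, Finset.mul_sum]
    refine Eq.trans ?_ Finset.sum_comm
    refine Finset.sum_congr rfl fun i _ => ?_
    rw [sum_mul_condAvg_comm]
    simp only [Finset.mul_sum]
    refine Eq.trans ?_ Finset.sum_comm
    refine Finset.sum_congr rfl fun j _ => ?_
    rw [← sum_mul_condAvg_comm]
  have hTT : ∑ c, W c * T c ^ 2 ≤ 16 * ∑ c, W c * (∑ i, ∑ j, f i j c) ^ 2 := by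
    have h1 : ∑ c, W c * T c ^ 2 ≤ 4 * ∑ c, W c * (∑ i, ∑ j, condAvg W (S j) (f i j) c) ^ 2 :=
      sum_sq_sum_condAvg_le hW rtot hR
        fun i c => Finset.sum_nonneg fun j _ => condAvg_nonneg hW _ (hf i j) c
    have h2 : ∑ c, W c * (∑ j, condAvg W (S j) (fun c => ∑ i, f i j c) c) ^ 2 ≤
        4 * ∑ c, W c * (∑ j, ∑ i, f i j c) ^ 2 :=
      sum_sq_sum_condAvg_le hW qtot hS fun j c => Finset.sum_nonneg fun i _ => hf i j c
    have h3 : ∀ c, ∑ i, ∑ j, condAvg W (S j) (f i j) c =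
        ∑ j, condAvg W (S j) (fun c => ∑ i, f i j c) c := by
      intro c
      rw [Finset.sum_comm]
      exact Finset.sum_congr rfl fun j _ => (condAvg_sum _ _ _ _ _).symm
    have h4 : ∀ c, ∑ j, ∑ i, f i j c = ∑ i, ∑ j, f i j c := fun c => Finset.sum_comm
    simp only [h3] at h1
    simp only [h4] at h2
    linarith
  have hCS : (∑ c, W c * (Z c * T c)) ^ 2 ≤ (∑ c, W c * Z c ^ 2) * ∑ c, W c * T c ^ 2 :=
    Finset.sum_sq_le_sum_mul_sum_of_sq_le_mul _
      (fun c _ => mul_nonneg (hW c) (sq_nonneg _)) (fun c _ => mul_nonneg (hW c) (sq_nonneg _))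
      (fun c _ => le_of_eq (by ring))
  rw [hZT]
  refine hCS.trans ?_
  have hZ0 : 0 ≤ ∑ c, W c * Z c ^ 2 :=
    Finset.sum_nonneg fun c _ => mul_nonneg (hW c) (sq_nonneg _)
  calc _ ≤ (∑ c, W c * Z c ^ 2) * (16 * ∑ c, W c * (∑ i, ∑ j, f i j c) ^ 2) :=
        mul_le_mul_of_nonneg_left hTT hZ0
    _ = _ := by ring

end CondAvg

/-! ### Second moment estimates for finitely many independent edges and finitely many times. -/

section EdgeSystem

variable {E ι J : Type*} [Fintype E] [Fintype ι] [Fintype J] [DecidableEq E] [DecidableEq J]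

open Classical in
/-- The properties of the law `π` of the states of an edge at the times in `J` that the second
moment estimates use; `q` is the order of time, and `ζ (y s)` the normalized indicator that the edge
is open at time `s`. -/
structure IsPathLaw (π : (J → Bool) → ℝ) (ζ : Bool → ℝ) (κ : J → J → ℝ) (q : J → J → Prop) :
    Prop where
  nonneg : ∀ y, 0 ≤ π y
  sum_eq_one : ∑ y, π y = 1
  mean : ∀ s, ∑ y, π y * ζ (y s) = 1
  cov : ∀ s s', ∑ y, π y * (ζ (y s) * ζ (y s')) = κ s s'
  markov : ∀ j s, q j s → ∀ x : J → Bool, x j = true →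
    ∑ y, (if ∀ k, q k j → y k = x k then π y * ζ (y s) else 0) =
      κ j s * ∑ y, (if ∀ k, q k j → y k = x k then π y else 0)

/-- The weight of a configuration when the edges are independent with law `π`. -/
def sysWeight (π : (J → Bool) → ℝ) (c : E → J → Bool) : ℝ := ∏ e, π (c e)

/-- The normalized indicator that the edges in `A` are open at time `s`. -/
def openInd (ζ : Bool → ℝ) (A : Finset E) (s : J) (c : E → J → Bool) : ℝ := ∏ e ∈ A, ζ (c e s)

variable {π : (J → Bool) → ℝ} {ζ : Bool → ℝ} {κ : J → J → ℝ} {q : J → J → Prop}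

theorem sum_prod_eq_prod_sum (φ : E → (J → Bool) → ℝ) :
    ∑ c : E → J → Bool, ∏ e, φ e (c e) = ∏ e, ∑ y, φ e y := by
  rw [Finset.prod_univ_sum, Fintype.piFinset_univ]

theorem prod_ite_mem_univ (A : Finset E) (g : E → ℝ) :
    ∏ e, (if e ∈ A then g e else 1) = ∏ e ∈ A, g e := by
  rw [Finset.prod_ite_mem, Finset.univ_inter]

omit [DecidableEq E] in
theorem IsPathLaw.sysWeight_nonneg (h : IsPathLaw π ζ κ q) (c : E → J → Bool) :
    0 ≤ sysWeight π c := Finset.prod_nonneg fun _ _ => h.nonneg _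

/-- The conditional expectation of a product over the edges. -/
theorem IsPathLaw.condAvg_prod (h : IsPathLaw π ζ κ q) (R : Setoid (E → J → Bool))
    {c : E → J → Bool} (hc : sysWeight π c ≠ 0) (A : E → (J → Bool) → Prop)
    [∀ e, DecidablePred (A e)]
    (hA : ∀ c', R c c' ↔ ∀ e, A e (c' e)) (ψ : E → (J → Bool) → ℝ) (v : E → ℝ)
    (hv : ∀ e, ∑ y, (if A e y then π y * ψ e y else 0) = v e * ∑ y, (if A e y then π y else 0)) :
    condAvg (sysWeight π) R (fun c' => ∏ e, ψ e (c' e)) c = ∏ e, v e := by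
  classical
  rw [condAvg, div_eq_iff (classWeight_pos h.sysWeight_nonneg R hc).ne']
  have h1 : ∀ φ : E → (J → Bool) → ℝ,
      ∑ c', (if R c c' then ∏ e, φ e (c' e) else 0) =
        ∏ e, ∑ y, if A e y then φ e y else 0 := by
    intro φ
    rw [← sum_prod_eq_prod_sum fun e y => if A e y then φ e y else 0]
    refine Finset.sum_congr rfl fun c' _ => ?_
    rw [Finset.prod_ite_zero]
    simp only [hA, Finset.mem_univ, true_imp_iff]
  have h2 := h1 fun e y => π y * ψ e y
  have h3 := h1 fun _ y => π y
  simp only [Finset.prod_mul_distrib] at h2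
  change ∑ c', (if R c c' then (∏ e, π (c' e)) * ∏ e, ψ e (c' e) else 0) =
    (∏ e, v e) * ∑ c', if R c c' then ∏ e, π (c' e) else 0
  rw [h2, h3, ← Finset.prod_mul_distrib]
  exact Finset.prod_congr rfl fun e _ => hv e

/-- Two configurations are identified if they agree, at all times, on the paths up to `i`. -/
def spaceSetoid (J : Type*) (r : ι → ι → Prop) (path : ι → Finset E) (i : ι) :
    Setoid (E → J → Bool) where
  r c c' := ∀ e, (∃ i', r i' i ∧ e ∈ path i') → c e = c' e
  iseqv := ⟨fun _ _ _ => rfl, fun h e he => (h e he).symm,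
    fun h h' e he => (h e he).trans (h' e he)⟩

/-- Two configurations are identified if they agree up to time `j`. -/
def timeSetoid (E : Type*) (q : J → J → Prop) (j : J) : Setoid (E → J → Bool) where
  r c c' := ∀ e k, q k j → c e k = c' e k
  iseqv := ⟨fun _ _ _ _ => rfl, fun h e k he => (h e k he).symm,
    fun h h' e k he => (h e k he).trans (h' e k he)⟩

/-- Edges on the paths up to `i` are frozen and all others average to one. Betweenness ensures that
a frozen edge of `path w` lies on `path i`, so exactly the common edges survive. -/
theorem IsPathLaw.condAvg_space (h : IsPathLaw π ζ κ q) {r : ι → ι → Prop}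
    (rtot : ∀ i j, r i j ∨ r j i) {path : ι → Finset E}
    (btw : ∀ i j k, r i j → r j k → path i ∩ path k ⊆ path j)
    {i w : ι} (hw : r i w) (s : J) {c : E → J → Bool} (hc : sysWeight π c ≠ 0) :
    condAvg (sysWeight π) (spaceSetoid J r path i) (openInd ζ (path w) s) c =
      openInd ζ (path i ∩ path w) s c := by
  classical
  have h1 := h.condAvg_prod (spaceSetoid J r path i) hc
    (fun e y => (∃ i', r i' i ∧ e ∈ path i') → c e = y) (fun c' => Iff.rfl)
    (fun e y => if e ∈ path w then ζ (y s) else 1)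
    (fun e => if e ∈ path i ∩ path w then ζ (c e s) else 1) ?_
  · simp only [prod_ite_mem_univ] at h1
    exact h1
  · intro e
    by_cases hE : ∃ i', r i' i ∧ e ∈ path i'
    · simp only [hE, true_imp_iff]
      simp only [Finset.sum_ite_eq, Finset.mem_univ, if_true]
      rw [mul_comm]
      congr 1
      obtain ⟨i', hi', he'⟩ := hE
      by_cases hew : e ∈ path w
      · have : e ∈ path i := btw i' i w hi' hw (Finset.mem_inter.2 ⟨he', hew⟩)
        simp [hew, this]
      · simp [hew]
    · have hei : e ∉ path i := fun he => hE ⟨i, (rtot i i).elim id id, he⟩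
      simp only [hE, false_imp_iff, if_true, Finset.mem_inter, hei, false_and, if_false, one_mul]
      by_cases hew : e ∈ path w
      · simp only [hew, if_true, h.mean, h.sum_eq_one]
      · simp [hew]

/-- The average factors over the edges: by the Markov property each edge of `A`, being open at `j`,
contributes `κ j s` whatever the rest of its past. -/
theorem IsPathLaw.condAvg_time (h : IsPathLaw π ζ κ q) {j s : J} (hjs : q j s) (A : Finset E)
    {c : E → J → Bool} (hc : sysWeight π c ≠ 0) (hA : ∀ e ∈ A, c e j = true) :
    condAvg (sysWeight π) (timeSetoid E q j) (openInd ζ A s) c = κ j s ^ A.card := by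
  classical
  have h1 := h.condAvg_prod (timeSetoid E q j) hc
    (fun e y => ∀ k, q k j → y k = c e k)
    (fun c' => forall_congr' fun e => forall₂_congr fun k _ => eq_comm)
    (fun e y => if e ∈ A then ζ (y s) else 1)
    (fun e => if e ∈ A then κ j s else 1) ?_
  · simp only [prod_ite_mem_univ, Finset.prod_const] at h1
    exact h1
  · intro e
    by_cases heA : e ∈ A
    · simp only [heA, if_true]
      convert h.markov j s hjs (c e) (hA e heA)
    · simp [heA]

theorem IsPathLaw.sum_openInd (h : IsPathLaw π ζ κ q) (A : Finset E) (s : J) :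
    ∑ c, sysWeight π c * openInd ζ A s c = 1 := by
  have h1 := sum_prod_eq_prod_sum (E := E) fun e y => π y * if e ∈ A then ζ (y s) else 1
  simp only [Finset.prod_mul_distrib, prod_ite_mem_univ] at h1
  change ∑ c : E → J → Bool, (∏ e, π (c e)) * ∏ e ∈ A, ζ (c e s) = 1
  rw [h1]
  refine Finset.prod_eq_one fun e _ => ?_
  split_ifs
  · exact h.mean s
  · simpa using h.sum_eq_one

/-- A common edge contributes its covariance, an edge of only one of the sets its mean one. This
turns correlations into the energy kernel. -/
theorem IsPathLaw.sum_openInd_mul (h : IsPathLaw π ζ κ q) (A B : Finset E) (s s' : J) :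
    ∑ c, sysWeight π c * (openInd ζ A s c * openInd ζ B s' c) = κ s s' ^ (A ∩ B).card := by
  have h1 := sum_prod_eq_prod_sum (E := E) fun e y =>
    π y * ((if e ∈ A then ζ (y s) else 1) * if e ∈ B then ζ (y s') else 1)
  simp only [Finset.prod_mul_distrib, prod_ite_mem_univ] at h1
  change ∑ c : E → J → Bool, (∏ e, π (c e)) * ((∏ e ∈ A, ζ (c e s)) * ∏ e ∈ B, ζ (c e s')) = _
  rw [h1, ← Finset.prod_const, ← prod_ite_mem_univ (A ∩ B)]
  refine Finset.prod_congr rfl fun e _ => ?_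
  by_cases hA : e ∈ A <;> by_cases hB : e ∈ B <;>
    simp [hA, hB, h.mean, h.cov, h.sum_eq_one]

/-- The energy of the weights `a` for the kernel `κ ^ |path i ∩ path w|`. -/
def sysEnergy (κ : J → J → ℝ) (path : ι → Finset E) (a : ι → J → ℝ) : ℝ :=
  ∑ i, ∑ j, ∑ w, ∑ s, a i j * a w s * κ j s ^ (path i ∩ path w).card

theorem IsPathLaw.sum_sq_eq_sysEnergy (h : IsPathLaw π ζ κ q) (path : ι → Finset E)
    (a : ι → J → ℝ) :
    ∑ c, sysWeight π c * (∑ i, ∑ j, a i j * openInd ζ (path i) j c) ^ 2 = sysEnergy κ path a := by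
  have h1 : ∀ c : E → J → Bool, sysWeight π c * (∑ i, ∑ j, a i j * openInd ζ (path i) j c) ^ 2 =
      ∑ i, ∑ j, ∑ w, ∑ s, a i j * a w s *
        (sysWeight π c * (openInd ζ (path i) j c * openInd ζ (path w) s c)) := by
    intro c
    rw [sq]
    simp only [Finset.sum_mul, Finset.mul_sum]
    refine Finset.sum_congr rfl fun i _ => Finset.sum_congr rfl fun j _ =>
      Finset.sum_congr rfl fun w _ => Finset.sum_congr rfl fun s _ => ?_
    ring
  simp only [h1]
  rw [sysEnergy, Finset.sum_comm]
  refine Finset.sum_congr rfl fun i _ => ?_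
  rw [Finset.sum_comm]
  refine Finset.sum_congr rfl fun j _ => ?_
  rw [Finset.sum_comm]
  refine Finset.sum_congr rfl fun w _ => ?_
  rw [Finset.sum_comm]
  refine Finset.sum_congr rfl fun s _ => ?_
  rw [← Finset.mul_sum, h.sum_openInd_mul]

/-- Some path is open at some time. -/
def Hit (path : ι → Finset E) (c : E → J → Bool) : Prop := ∃ i j, ∀ e ∈ path i, c e j = true

open Classical in
/-- The probability that some path is open at some time. -/
noncomputable def hitWeight (π : (J → Bool) → ℝ) (path : ι → Finset E) : ℝ :=
  ∑ c, if Hit path c then sysWeight π c else 0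

/-- The second moment bound. -/
theorem IsPathLaw.one_le_hitWeight_mul (h : IsPathLaw π ζ κ q) (hζ : ζ false = 0)
    (path : ι → Finset E) {a : ι → J → ℝ} (ha : ∑ i, ∑ j, a i j = 1) :
    1 ≤ hitWeight π path * sysEnergy κ path a := by
  classical
  set Z : (E → J → Bool) → ℝ := fun c => ∑ i, ∑ j, a i j * openInd ζ (path i) j c with hZ
  have hEZ : ∑ c, sysWeight π c * Z c = 1 := by
    simp only [hZ, Finset.mul_sum]
    rw [Finset.sum_comm, ← ha]
    refine Finset.sum_congr rfl fun i _ => ?_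
    rw [Finset.sum_comm]
    refine Finset.sum_congr rfl fun j _ => ?_
    calc _ = ∑ c, a i j * (sysWeight π c * openInd ζ (path i) j c) :=
          Finset.sum_congr rfl fun c _ => by ring
      _ = _ := by rw [← Finset.mul_sum, h.sum_openInd, mul_one]
  have hZ0 : ∀ c, ¬ Hit path c → Z c = 0 := by
    intro c hc
    refine Finset.sum_eq_zero fun i _ => Finset.sum_eq_zero fun j _ => ?_
    have : ∃ e ∈ path i, c e j ≠ true := by
      by_contra hne
      push Not at hne
      exact hc ⟨i, j, hne⟩
    obtain ⟨e, he, hce⟩ := this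
    rw [openInd, Finset.prod_eq_zero he, mul_zero]
    rw [Bool.eq_false_of_not_eq_true hce, hζ]
  -- Cauchy–Schwarz restricted to the hitting event, outside of which `Z` vanishes.
  have hCS : (∑ c, sysWeight π c * Z c) ^ 2 ≤
      (∑ c, if Hit path c then sysWeight π c else 0) * ∑ c, sysWeight π c * Z c ^ 2 := by
    refine Finset.sum_sq_le_sum_mul_sum_of_sq_le_mul _ (fun c _ => ?_)
      (fun c _ => mul_nonneg (h.sysWeight_nonneg c) (sq_nonneg _)) (fun c _ => ?_)
    · split_ifs <;> simp [h.sysWeight_nonneg]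
    · split_ifs with hc
      · exact le_of_eq (by ring)
      · simp [hZ0 c hc]
  rw [hEZ, one_pow, h.sum_sq_eq_sysEnergy] at hCS
  exact hCS

/-- The contribution of one quadrant to the energy. -/
theorem IsPathLaw.sq_quadrant_le (h : IsPathLaw π ζ κ q) (hζ : ∀ b, 0 ≤ ζ b)
    (qtot : ∀ i j, q i j ∨ q j i) (qtr : ∀ i j k, q i j → q j k → q i k)
    {r : ι → ι → Prop} (rtot : ∀ i j, r i j ∨ r j i) (rtr : ∀ i j k, r i j → r j k → r i k)
    {path : ι → Finset E} (btw : ∀ i j k, r i j → r j k → path i ∩ path k ⊆ path j)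
    {f : ι → J → (E → J → Bool) → ℝ} (hf : ∀ i j c, 0 ≤ f i j c)
    (hfo : ∀ i j c, f i j c ≠ 0 → ∀ e ∈ path i, c e j = true)
    {a : ι → J → ℝ} (ha : ∀ i j, 0 ≤ a i j) [DecidableRel r] [DecidableRel q] :
    (∑ i, ∑ j, ∑ w, ∑ s, if r i w ∧ q j s then
      (∑ c, sysWeight π c * f i j c) * a w s * κ j s ^ (path i ∩ path w).card else 0) ^ 2 ≤
      16 * sysEnergy κ path a * ∑ c, sysWeight π c * (∑ i, ∑ j, f i j c) ^ 2 := by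
  have hκ : ∀ s s', 0 ≤ κ s s' := fun s s' => by
    rw [← h.cov s s']
    exact Finset.sum_nonneg fun y _ => mul_nonneg (h.nonneg y) (mul_nonneg (hζ _) (hζ _))
  have hO : ∀ A s (c : E → J → Bool), 0 ≤ openInd ζ A s c :=
    fun A s c => Finset.prod_nonneg fun _ _ => hζ _
  set Z : (E → J → Bool) → ℝ := fun c => ∑ i, ∑ j, a i j * openInd ζ (path i) j c with hZ
  have hmain := sq_sum_condAvg_condAvg_le (W := sysWeight (E := E) π) h.sysWeight_nonneg rtot
    (R := spaceSetoid J r path)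
    (fun i j hij c c' hcc e ⟨i', hi', he⟩ => hcc e ⟨i', rtr _ _ _ hi' hij, he⟩) qtot
    (S := timeSetoid E q) (fun i j hij c c' hcc e k hk => hcc e k (qtr _ _ _ hk hij)) hf Z
  rw [h.sum_sq_eq_sysEnergy] at hmain
  refine le_trans (pow_le_pow_left₀ ?_ ?_ 2) hmain
  · refine Finset.sum_nonneg fun i _ => Finset.sum_nonneg fun j _ => Finset.sum_nonneg fun w _ =>
      Finset.sum_nonneg fun s _ => ?_
    split_ifs
    · exact mul_nonneg (mul_nonneg (Finset.sum_nonneg fun c _ =>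
        mul_nonneg (h.sysWeight_nonneg c) (hf i j c)) (ha w s)) (pow_nonneg (hκ _ _) _)
    · exact le_rfl
  · refine Finset.sum_le_sum fun i _ => Finset.sum_le_sum fun j _ => ?_
    have hlin : ∀ c, condAvg (sysWeight π) (timeSetoid E q j)
        (condAvg (sysWeight π) (spaceSetoid J r path i) Z) c =
        ∑ w, ∑ s, a w s * condAvg (sysWeight π) (timeSetoid E q j)
          (condAvg (sysWeight π) (spaceSetoid J r path i) (openInd ζ (path w) s)) c := by
      intro c
      have h1 : condAvg (sysWeight π) (spaceSetoid J r path i) Z = fun c => ∑ w, ∑ s, a w s *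
          condAvg (sysWeight π) (spaceSetoid J r path i) (openInd ζ (path w) s) c := by
        funext c
        simp only [hZ, condAvg_sum, condAvg_const_mul]
      simp only [h1, condAvg_sum, condAvg_const_mul]
    have hEE : ∀ c w s, 0 ≤ condAvg (sysWeight π) (timeSetoid E q j)
          (condAvg (sysWeight π) (spaceSetoid J r path i) (openInd ζ (path w) s)) c :=
      fun c w s => condAvg_nonneg h.sysWeight_nonneg _ (condAvg_nonneg h.sysWeight_nonneg _ (hO _ _)) c
    -- Where `f i j` does not vanish, `path i` is open at `j`, so the space average followed by the
    -- time average is deterministic. Outside the quadrant only nonnegativity of the averages is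
    -- used.
    have hval : ∀ c, sysWeight π c ≠ 0 → f i j c ≠ 0 → ∀ w s, r i w → q j s →
        condAvg (sysWeight π) (timeSetoid E q j)
          (condAvg (sysWeight π) (spaceSetoid J r path i) (openInd ζ (path w) s)) c =
        κ j s ^ (path i ∩ path w).card := by
      intro c hc hfc w s hw hs
      rw [condAvg_congr h.sysWeight_nonneg _ fun c' hc' => h.condAvg_space rtot btw hw s hc']
      exact h.condAvg_time hs _ hc fun e he => hfo i j c hfc e (Finset.mem_inter.1 he).1
    calc _ = ∑ c, sysWeight π c * ((∑ w, ∑ s, if r i w ∧ q j s then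
            a w s * κ j s ^ (path i ∩ path w).card else 0) * f i j c) := by
          simp only [Finset.sum_mul, Finset.mul_sum]
          refine Eq.trans (Finset.sum_congr rfl fun w _ => ?_) Finset.sum_comm
          refine Eq.trans (Finset.sum_congr rfl fun s _ => ?_) Finset.sum_comm
          split_ifs
          · exact Finset.sum_congr rfl fun c _ => by ring
          · simp
      _ ≤ _ := by
          refine Finset.sum_le_sum fun c _ => ?_
          by_cases hc : sysWeight π c = 0
          · simp [hc]
          by_cases hfc : f i j c = 0
          · simp [hfc]
          refine mul_le_mul_of_nonneg_left (mul_le_mul_of_nonneg_right ?_ (hf i j c))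
            (h.sysWeight_nonneg c)
          rw [hlin]
          refine Finset.sum_le_sum fun w _ => Finset.sum_le_sum fun s _ => ?_
          split_ifs with hws
          · rw [hval c hc hfc w s hws.1 hws.2]
          · exact mul_nonneg (ha w s) (hEE c w s)

/-- The capacity bound: a multiple of the inverse hitting probability is the energy of a suitable
probability vector. -/
theorem IsPathLaw.exists_energy_le (h : IsPathLaw π ζ κ q)
    (h' : IsPathLaw π ζ κ fun i j => q j i) (hζ : ∀ b, 0 ≤ ζ b)
    (qtot : ∀ i j, q i j ∨ q j i) (qtr : ∀ i j k, q i j → q j k → q i k)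
    {r : ι → ι → Prop} (rtot : ∀ i j, r i j ∨ r j i) (rtr : ∀ i j k, r i j → r j k → r i k)
    {path : ι → Finset E} (btw : ∀ i j k, r i j → r j k → path i ∩ path k ⊆ path j)
    (hpos : 0 < hitWeight π path) :
    ∃ a : ι → J → ℝ, (∀ i j, 0 ≤ a i j) ∧ ∑ i, ∑ j, a i j = 1 ∧
      hitWeight π path * sysEnergy κ path a ≤ 256 := by
  classical
  have hκ : ∀ s s', 0 ≤ κ s s' := fun s s' => by
    rw [← h.cov s s']
    exact Finset.sum_nonneg fun y _ => mul_nonneg (h.nonneg y) (mul_nonneg (hζ _) (hζ _))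
  obtain ⟨c₀, -, hc₀⟩ := Finset.exists_ne_zero_of_sum_ne_zero hpos.ne'
  have hc₀' : Hit path c₀ := by
    by_contra hne
    simp [hne] at hc₀
  obtain ⟨i₀, j₀, -⟩ := hc₀'
  -- Any choice of an open pair will do: the dual Doob inequality does not require the choice to be
  -- adapted, as a first hitting time would be.
  have hsel : ∀ c : E → J → Bool, ∃ x : ι × J, Hit path c → ∀ e ∈ path x.1, c e x.2 = true := by
    intro c
    by_cases hc : Hit path c
    · obtain ⟨i, j, hij⟩ := hc
      exact ⟨(i, j), fun _ => hij⟩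
    · exact ⟨(i₀, j₀), fun hc' => absurd hc' hc⟩
  choose sel hsel using hsel
  set f : ι → J → (E → J → Bool) → ℝ := fun i j c => if Hit path c ∧ sel c = (i, j) then 1 else 0
    with hfdef
  have hf : ∀ i j c, 0 ≤ f i j c := fun i j c => by simp only [hfdef]; split_ifs <;> simp
  have hfo : ∀ i j c, f i j c ≠ 0 → ∀ e ∈ path i, c e j = true := by
    intro i j c hfc
    have : Hit path c ∧ sel c = (i, j) := by
      by_contra hne
      simp [hfdef, hne] at hfc
    have h1 := hsel c this.1
    rw [this.2] at h1
    exact h1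
  have hsum : ∀ c, ∑ i, ∑ j, f i j c = if Hit path c then 1 else 0 := by
    intro c
    rw [← Fintype.sum_prod_type' (f := fun i j => f i j c)]
    simp only [hfdef]
    by_cases hc : Hit path c <;> simp [hc]
  set PH := hitWeight π path with hPH
  set b : ι → J → ℝ := fun i j => ∑ c, sysWeight π c * f i j c with hb
  have hb0 : ∀ i j, 0 ≤ b i j := fun i j =>
    Finset.sum_nonneg fun c _ => mul_nonneg (h.sysWeight_nonneg c) (hf i j c)
  have hbsum : ∑ i, ∑ j, b i j = PH := by
    have : ∀ i, ∑ j, b i j = ∑ c, sysWeight π c * ∑ j, f i j c := by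
      intro i
      simp only [hb, Finset.mul_sum]
      exact Finset.sum_comm
    simp only [this]
    rw [Finset.sum_comm]
    simp only [← Finset.mul_sum, hsum]
    simp [hPH, hitWeight]
  have hfsq : ∑ c, sysWeight π c * (∑ i, ∑ j, f i j c) ^ 2 = PH := by
    simp only [hsum]
    simp [hPH, hitWeight]
  set a : ι → J → ℝ := fun i j => b i j / PH with ha
  have ha0 : ∀ i j, 0 ≤ a i j := fun i j => div_nonneg (hb0 i j) hpos.le
  refine ⟨a, ha0, ?_, ?_⟩
  · simp only [ha, ← Finset.sum_div, hbsum]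
    exact div_self hpos.ne'
  set K : ι → J → ι → J → ℝ := fun i j w s => b i j * a w s * κ j s ^ (path i ∩ path w).card
    with hK
  have hK0 : ∀ i j w s, 0 ≤ K i j w s := fun i j w s =>
    mul_nonneg (mul_nonneg (hb0 i j) (ha0 w s)) (pow_nonneg (hκ _ _) _)
  -- One estimate for each combination of the two orders with their reverses; betweenness is
  -- symmetric, and `h'` is the Markov property backwards in time.
  have hQ1 := h.sq_quadrant_le hζ qtot qtr rtot rtr btw hf hfo ha0
  have hQ2 := h.sq_quadrant_le hζ qtot qtr (r := fun i j => r j i) (fun i j => rtot j i)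
    (fun i j k h1 h2 => rtr k j i h2 h1)
    (fun i j k h1 h2 => by rw [Finset.inter_comm]; exact btw k j i h2 h1) hf hfo ha0
  have hQ3 := h'.sq_quadrant_le hζ (fun i j => qtot j i) (fun i j k h1 h2 => qtr k j i h2 h1)
    rtot rtr btw hf hfo ha0
  have hQ4 := h'.sq_quadrant_le hζ (fun i j => qtot j i) (fun i j k h1 h2 => qtr k j i h2 h1)
    (r := fun i j => r j i) (fun i j => rtot j i)
    (fun i j k h1 h2 => rtr k j i h2 h1)
    (fun i j k h1 h2 => by rw [Finset.inter_comm]; exact btw k j i h2 h1) hf hfo ha0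
  rw [hfsq] at hQ1 hQ2 hQ3 hQ4
  set I := sysEnergy κ path a with hI
  have hB : PH * I = ∑ i, ∑ j, ∑ w, ∑ s, K i j w s := by
    rw [hI, sysEnergy]
    simp only [Finset.mul_sum]
    refine Finset.sum_congr rfl fun i _ => Finset.sum_congr rfl fun j _ =>
      Finset.sum_congr rfl fun w _ => Finset.sum_congr rfl fun s _ => ?_
    have : b i j = PH * a i j := by rw [ha, mul_div_cancel₀ _ hpos.ne']
    rw [hK]
    simp only [this]
    ring
  have hI0 : 0 ≤ PH * I := by
    rw [hB]
    exact Finset.sum_nonneg fun i _ => Finset.sum_nonneg fun j _ => Finset.sum_nonneg fun w _ =>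
      Finset.sum_nonneg fun s _ => hK0 i j w s
  have hle : PH * I ≤ ((∑ i, ∑ j, ∑ w, ∑ s, if r i w ∧ q j s then K i j w s else 0) +
      (∑ i, ∑ j, ∑ w, ∑ s, if r w i ∧ q j s then K i j w s else 0)) +
      ((∑ i, ∑ j, ∑ w, ∑ s, if r i w ∧ q s j then K i j w s else 0) +
      (∑ i, ∑ j, ∑ w, ∑ s, if r w i ∧ q s j then K i j w s else 0)) := by
    rw [hB]
    simp only [← Finset.sum_add_distrib]
    refine Finset.sum_le_sum fun i _ => Finset.sum_le_sum fun j _ => Finset.sum_le_sum fun w _ =>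
      Finset.sum_le_sum fun s _ => ?_
    have := hK0 i j w s
    rcases rtot i w with h1 | h1 <;> rcases qtot j s with h2 | h2 <;> simp only [h1, h2, true_and,
      and_true, if_true] <;> split_ifs <;> linarith
  set Q1 := ∑ i, ∑ j, ∑ w, ∑ s, if r i w ∧ q j s then K i j w s else 0
  set Q2 := ∑ i, ∑ j, ∑ w, ∑ s, if r w i ∧ q j s then K i j w s else 0
  set Q3 := ∑ i, ∑ j, ∑ w, ∑ s, if r i w ∧ q s j then K i j w s else 0
  set Q4 := ∑ i, ∑ j, ∑ w, ∑ s, if r w i ∧ q s j then K i j w s else 0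
  change Q1 ^ 2 ≤ _ at hQ1
  change Q2 ^ 2 ≤ _ at hQ2
  change Q3 ^ 2 ≤ _ at hQ3
  change Q4 ^ 2 ≤ _ at hQ4
  -- Four squares, each at most `16 * I * PH`, and a factor 4 from squaring a sum of four terms: `4
  -- * 4 * 16 = 256`.
  have hsq : (PH * I) ^ 2 ≤ 256 * (PH * I) := by
    calc (PH * I) ^ 2 ≤ (Q1 + Q2 + (Q3 + Q4)) ^ 2 := pow_le_pow_left₀ hI0 hle 2
      _ ≤ 4 * (Q1 ^ 2 + Q2 ^ 2 + Q3 ^ 2 + Q4 ^ 2) := by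
        nlinarith [sq_nonneg (Q1 - Q2), sq_nonneg (Q1 - Q3), sq_nonneg (Q1 - Q4),
          sq_nonneg (Q2 - Q3), sq_nonneg (Q2 - Q4), sq_nonneg (Q3 - Q4)]
      _ ≤ 256 * (PH * I) := by linarith
  by_contra hne
  push Not at hne
  nlinarith

end EdgeSystem

/-! ### Rays of a tree: common edges, lexicographic order, compactness of the boundary. -/

namespace Boundary

variable {V : Type*} {G : SimpleGraph V} {ρ : V}

/-- The `k`-th edge of a ray. -/
def edge (v : Boundary G ρ) (k : ℕ) : G.edgeSet :=
  ⟨s(v.vertex k, v.vertex (k + 1)), v.adj k⟩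

/-- The initial segment of a ray, as a walk. -/
def walk (v : Boundary G ρ) : ∀ k, G.Walk (v.vertex 0) (v.vertex k)
  | 0 => .nil
  | k + 1 => (walk v k).concat (v.adj k)

theorem support_walk (v : Boundary G ρ) (k : ℕ) :
    (v.walk k).support = (List.range (k + 1)).map v.vertex := by
  induction k with
  | zero => simp [walk]
  | succ k ih =>
    rw [walk, SimpleGraph.Walk.support_concat, ih, List.range_succ (n := k + 1), List.map_append]
    simp

theorem isPath_walk (v : Boundary G ρ) (k : ℕ) : (v.walk k).IsPath := by
  rw [SimpleGraph.Walk.isPath_def, support_walk]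
  exact (List.nodup_range).map v.injective

/-- Paths in a tree are unique, so the initial segments ending at the common vertex have the same
list of vertices. -/
theorem eq_of_vertex_eq (hG : G.IsTree) {v w : Boundary G ρ} {k l : ℕ}
    (h : v.vertex k = w.vertex l) : k = l ∧ ∀ i ≤ k, v.vertex i = w.vertex i := by
  have h0 : w.vertex 0 = v.vertex 0 := w.start.trans v.start.symm
  have h1 := (hG.isAcyclic.subsingleton_path _ _).elim ⟨v.walk k, v.isPath_walk k⟩
    ⟨(w.walk l).copy h0 h.symm, by simpa using w.isPath_walk l⟩
  have h2 := congrArg (fun p : G.Path _ _ => p.1.support) h1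
  simp only [SimpleGraph.Walk.support_copy, support_walk] at h2
  have h3 : k = l := by
    have := congrArg List.length h2
    simpa using this
  subst h3
  refine ⟨rfl, fun i hi => ?_⟩
  have h4 := List.map_inj_left.1 h2 i (by simp; omega)
  exact h4

theorem edge_eq_iff (hG : G.IsTree) {v w : Boundary G ρ} {k l : ℕ} :
    v.edge k = w.edge l ↔ k = l ∧ ∀ i ≤ k + 1, v.vertex i = w.vertex i := by
  constructor
  · intro h
    have h1 : s(v.vertex k, v.vertex (k + 1)) = s(w.vertex l, w.vertex (l + 1)) :=
      congrArg Subtype.val h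
    rcases Sym2.eq_iff.1 h1 with ⟨h2, h3⟩ | ⟨h2, h3⟩
    · exact ⟨(eq_of_vertex_eq hG h2).1, (eq_of_vertex_eq hG h3).2⟩
    -- With opposite orientations the heights would satisfy `k = l + 1` and `k + 1 = l`.
    · have := (eq_of_vertex_eq hG h2).1
      have := (eq_of_vertex_eq hG h3).1
      omega
  · rintro ⟨rfl, h⟩
    simp only [edge, h k (by omega), h (k + 1) le_rfl]

open Classical in
/-- The set of the first `n` edges of a ray. -/
noncomputable def path (n : ℕ) (v : Boundary G ρ) : Finset G.edgeSet :=
  (Finset.range n).image v.edge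

theorem mem_path {n : ℕ} {v : Boundary G ρ} {e : G.edgeSet} :
    e ∈ v.path n ↔ ∃ k < n, v.edge k = e := by
  simp [path]

/-- The height of the last common vertex of two rays, cut off at `n`. -/
noncomputable def meetUpTo (n : ℕ) (v w : Boundary G ρ) : ℕ := (min (n : ℕ∞) (meetHeight v w)).toNat

theorem le_meetUpTo_iff {n k : ℕ} {v w : Boundary G ρ} :
    k ≤ meetUpTo n v w ↔ k ≤ n ∧ ∀ i ≤ k, v.vertex i = w.vertex i := by
  have hne : min (n : ℕ∞) (meetHeight v w) ≠ ⊤ :=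
    ne_top_of_le_ne_top (ENat.natCast_ne_top n) (min_le_left _ _)
  rw [meetUpTo, ← le_meetHeight_iff, ← Nat.cast_le (α := ℕ∞), ENat.natCast_toNat hne, le_min_iff,
    Nat.cast_le]

-- Rays that have separated never share an edge again, so the common edges are those below the last
-- common vertex. This identifies the exponent in the edge system with that in `h`.
open Classical in
theorem card_path_inter (hG : G.IsTree) (n : ℕ) (v w : Boundary G ρ) :
    (v.path n ∩ w.path n).card = meetUpTo n v w := by
  have h1 : v.path n ∩ w.path n = (Finset.range (meetUpTo n v w)).image v.edge := by
    ext e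
    simp only [Finset.mem_inter, mem_path, Finset.mem_image, Finset.mem_range]
    constructor
    · rintro ⟨⟨k, hk, rfl⟩, l, hl, h⟩
      obtain ⟨rfl, h2⟩ := (edge_eq_iff hG).1 h
      exact ⟨l, le_meetUpTo_iff.2 ⟨hk, fun i hi => (h2 i hi).symm⟩, rfl⟩
    · rintro ⟨k, hk, rfl⟩
      obtain ⟨h1, h2⟩ := le_meetUpTo_iff.1 (Nat.succ_le_of_lt hk)
      exact ⟨⟨k, h1, rfl⟩, k, h1, ((edge_eq_iff hG).2 ⟨rfl, h2⟩).symm⟩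
  rw [h1, Finset.card_image_of_injective, Finset.card_range]
  intro k l h
  exact ((edge_eq_iff hG).1 h).1

theorem path_eq_of_agree {n : ℕ} {v w : Boundary G ρ}
    (h : ∀ i ≤ n, v.vertex i = w.vertex i) {k : ℕ} (hk : k < n) : v.edge k = w.edge k := by
  simp only [edge, h k (by omega), h (k + 1) (by omega)]

theorem finite_range_vertex (hfin : ∀ v, (G.neighborSet v).Finite) (n : ℕ) :
    (range fun v : Boundary G ρ => v.vertex n).Finite := by
  induction n with
  | zero =>
    refine (finite_singleton ρ).subset ?_
    rintro _ ⟨v, rfl⟩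
    exact v.start
  | succ n ih =>
    refine (ih.biUnion fun u _ => hfin u).subset ?_
    rintro _ ⟨v, rfl⟩
    exact mem_biUnion (mem_range_self v) (v.adj n)

/-- Sequences with a given prefix form an interval of the lexicographic order: inductively, `b i` is
squeezed between `a i` and `c i`, which agree. -/
theorem lex_between {n : ℕ} {α : Type*} [LinearOrder α] {a b c : Lex (Fin n → α)} (hab : a ≤ b)
    (hbc : b ≤ c) {k : ℕ} (hac : ∀ i : Fin n, (i : ℕ) ≤ k → a i = c i) :
    ∀ i : Fin n, (i : ℕ) ≤ k → a i = b i := by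
  have key : ∀ {a b : Lex (Fin n → α)}, a ≤ b → ∀ i, (∀ j < i, a j = b j) → a i ≤ b i := by
    intro a b hab i hi
    rcases hab.eq_or_lt with rfl | hlt
    · exact le_rfl
    · obtain ⟨j, hj, hjlt⟩ := hlt
      rcases lt_trichotomy i j with h | rfl | h
      · exact (hj i h).le
      · exact hjlt.le
      · exact absurd (hi j h) hjlt.ne
  intro i
  induction i using WellFoundedLT.induction with
  | _ i ih =>
    intro hik
    have h1 : ∀ j < i, a j = b j := fun j hj => ih j hj (le_trans (le_of_lt hj) hik)
    refine (key hab i h1).antisymm ?_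
    rw [hac i hik]
    refine key hbc i fun j hj => ?_
    rw [← h1 j hj, hac j (le_trans (le_of_lt hj) hik)]

/-- Finitely many rays represent all initial segments of length `n`, and they can be ordered so that
the rays with a given initial segment form an interval. -/
theorem exists_ordered_family (hG : G.IsTree) (hfin : ∀ v, (G.neighborSet v).Finite) (ρ : V)
    (n : ℕ) : ∃ (N : ℕ) (ray : Fin N → Boundary G ρ) (r : Fin N → Fin N → Prop),
      (∀ v : Boundary G ρ, ∃ i, ∀ k ≤ n, v.vertex k = (ray i).vertex k) ∧
      (∀ i j, r i j ∨ r j i) ∧ (∀ i j k, r i j → r j k → r i k) ∧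
      ∀ i j k, r i j → r j k → ∀ e ∈ (ray i).path n, e ∈ (ray k).path n → e ∈ (ray j).path n := by
  classical
  -- An arbitrary linear order of the vertices suffices; the rays are compared through their first
  -- `n + 1` vertices.
  let _ : LinearOrder V := IsWellOrder.linearOrder WellOrderingRel
  let pre : Boundary G ρ → Lex (Fin (n + 1) → V) := fun v => toLex fun i => v.vertex i
  have hS : (range pre).Finite := by
    have h1 : (Set.pi univ fun i : Fin (n + 1) => range fun v : Boundary G ρ => v.vertex i).Finite :=
      Set.Finite.pi fun i => finite_range_vertex hfin i
    refine Set.Finite.subset h1 ?_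
    rintro _ ⟨v, rfl⟩ i -
    exact ⟨v, rfl⟩
  let _ : Fintype (range pre) := hS.fintype
  let em : Fin (Fintype.card (range pre)) ≃ range pre := (Fintype.equivFin _).symm
  have hrep : ∀ i, ∃ v, pre v = (em i).1 := fun i => (em i).2
  choose ray hray using hrep
  refine ⟨_, ray, fun i j => pre (ray i) ≤ pre (ray j), fun v => ?_, fun i j => le_total _ _,
    fun i j k => le_trans, fun i j k hij hjk e hei hek => ?_⟩
  · refine ⟨em.symm ⟨pre v, mem_range_self v⟩, fun k hk => ?_⟩
    have h1 := hray (em.symm ⟨pre v, mem_range_self v⟩)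
    rw [Equiv.apply_symm_apply] at h1
    exact (congrFun h1 ⟨k, by omega⟩).symm
  · obtain ⟨k', hk', rfl⟩ := mem_path.1 hei
    obtain ⟨l, hl, h⟩ := mem_path.1 hek
    obtain ⟨rfl, h2⟩ := (edge_eq_iff hG).1 h
    have h3 := lex_between hij hjk (k := l + 1) fun i hi => (h2 i hi).symm
    refine mem_path.2 ⟨l, hl, (edge_eq_iff hG).2 ⟨rfl, fun i hi => ?_⟩⟩
    exact (h3 ⟨i, by omega⟩ hi).symm

theorem expNeg_natCast (n : ℕ) : expNeg n = Real.exp (-n) := by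
  simp [expNeg]

theorem dist_le_iff {v w : Boundary G ρ} {n : ℕ} :
    dist v w ≤ Real.exp (-n) ↔ ∀ k ≤ n, v.vertex k = w.vertex k := by
  rw [← le_meetHeight_iff]
  change expNeg (meetHeight v w) ≤ _ ↔ _
  constructor
  · intro h
    by_contra hlt
    push Not at hlt
    have hne : meetHeight v w ≠ ⊤ := ne_top_of_lt hlt
    rw [expNeg, if_neg hne, Real.exp_le_exp, neg_le_neg_iff, Nat.cast_le] at h
    rw [← ENat.natCast_toNat hne, Nat.cast_lt] at hlt
    omega
  · intro h
    rw [← expNeg_natCast]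
    exact expNeg_anti h

theorem exists_exp_neg_lt {ε : ℝ} (hε : 0 < ε) : ∃ n : ℕ, Real.exp (-n) < ε := by
  have h : Tendsto (fun n : ℕ => Real.exp (-n)) atTop (𝓝 0) :=
    Real.tendsto_exp_neg_atTop_nhds_zero.comp tendsto_natCast_atTop_atTop
  exact (h.eventually (gt_mem_nhds hε)).exists

/-- Each vertex of a Cauchy sequence of rays is eventually constant, and the limiting vertices form
a ray. Together with finiteness of the set of initial segments this gives compactness. -/
theorem completeSpace : CompleteSpace (Boundary G ρ) := by
  refine Metric.complete_of_cauchySeq_tendsto fun u hu => ?_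
  have h1 : ∀ n : ℕ, ∃ N, ∀ m ≥ N, ∀ k ≤ n, (u m).vertex k = (u N).vertex k := by
    intro n
    obtain ⟨N, hN⟩ := Metric.cauchySeq_iff'.1 hu _ (Real.exp_pos (-n))
    exact ⟨N, fun m hm => dist_le_iff.1 (hN m hm).le⟩
  choose N hN using h1
  have h2 : ∀ n m, N n ≤ m → (u m).vertex n = (u (N n)).vertex n :=
    fun n m hm => hN n m hm n le_rfl
  let v : Boundary G ρ :=
    { vertex := fun n => (u (N n)).vertex n
      start := (u (N 0)).start
      adj := fun n => by
        rw [← h2 n (max (N n) (N (n + 1))) (le_max_left _ _),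
          ← h2 (n + 1) (max (N n) (N (n + 1))) (le_max_right _ _)]
        exact (u _).adj n
      injective := fun k l hkl => by
        dsimp only at hkl
        rw [← h2 k (max (N k) (N l)) (le_max_left _ _),
          ← h2 l (max (N k) (N l)) (le_max_right _ _)] at hkl
        exact (u _).injective hkl }
  refine ⟨v, Metric.tendsto_atTop.2 fun ε hε => ?_⟩
  obtain ⟨n, hn⟩ := exists_exp_neg_lt hε
  refine ⟨N n, fun m hm => lt_of_le_of_lt (dist_le_iff.2 fun k hk => ?_) hn⟩
  rw [hN n m hm k hk]
  change _ = (u (N k)).vertex k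
  rw [← h2 k (max (N k) (N n)) (le_max_left _ _), ← hN n _ (le_max_right (N k) (N n)) k hk]

theorem compactSpace (hG : G.IsTree) (hfin : ∀ v, (G.neighborSet v).Finite) :
    CompactSpace (Boundary G ρ) := by
  have := completeSpace (G := G) (ρ := ρ)
  refine ⟨(Metric.totallyBounded_iff.2 fun ε hε => ?_).isCompact_of_isClosed
    isClosed_univ⟩
  obtain ⟨n, hn⟩ := exists_exp_neg_lt hε
  obtain ⟨N, ray, -, hcov, -⟩ := exists_ordered_family hG hfin ρ n
  refine ⟨range ray, finite_range ray, fun v _ => ?_⟩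
  obtain ⟨i, hi⟩ := hcov v
  exact mem_biUnion (mem_range_self i) (lt_of_le_of_lt (dist_le_iff.2 hi) hn)

end Boundary

/-! ### König's lemma: percolation is the same as open ray segments at all levels. -/

section Koenig

variable {V : Type*}

/-- An infinite connected component of a locally finite graph contains a geodesic ray. -/
theorem exists_geodesic_ray (H : SimpleGraph V) (hfin : ∀ v, (H.neighborSet v).Finite) (ρ : V)
    (hinf : {v | H.Reachable ρ v}.Infinite) :
    ∃ f : ℕ → V, f 0 = ρ ∧ (∀ n, H.Adj (f n) (f (n + 1))) ∧ ∀ n, H.dist ρ (f n) = n := by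
  -- `Desc v` consists of the vertices reached from `ρ` by a geodesic through `v`; the ray is built
  -- inside the vertices for which it is infinite.
  let Desc : V → Set V := fun v => {u | H.Reachable v u ∧ H.dist ρ u = H.dist ρ v + H.dist v u}
  let Big : V → Prop := fun v => H.Reachable ρ v ∧ (Desc v).Infinite
  have tri : ∀ {a b c}, H.Reachable a b → H.Reachable b c →
      H.dist a c ≤ H.dist a b + H.dist b c := by
    intro a b c hab hbc
    obtain ⟨p, hp⟩ := hab.exists_walk_length_eq_dist
    obtain ⟨p', hp'⟩ := hbc.exists_walk_length_eq_dist
    rw [← hp, ← hp', ← SimpleGraph.Walk.length_append]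
    exact H.dist_le _
  have step : ∀ v, Big v → ∃ w, H.Adj v w ∧ H.dist ρ w = H.dist ρ v + 1 ∧ Big w := by
    rintro v ⟨hv, hi⟩
    by_contra hne
    push Not at hne
    refine hi ?_
    -- The first step of a geodesic from `v` to a descendant leads to a neighbour one further from
    -- `ρ`, and there are finitely many neighbours.
    have hsub : Desc v ⊆ {v} ∪
        ⋃ w ∈ {w ∈ H.neighborSet v | H.dist ρ w = H.dist ρ v + 1}, Desc w := by
      rintro u ⟨hvu, hu⟩
      obtain ⟨p, hp⟩ := hvu.exists_walk_length_eq_dist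
      cases p with
      | nil => exact Or.inl rfl
      | @cons _ w _ hadj p' =>
        right
        rw [SimpleGraph.Walk.length_cons] at hp
        have hwu : H.Reachable w u := p'.reachable
        have h1 : H.dist w u ≤ p'.length := H.dist_le p'
        have h2 := tri (hv.trans hadj.reachable) hwu
        have h3 := tri hv hadj.reachable
        have h4 : H.dist v w = 1 := SimpleGraph.dist_eq_one_iff_adj.2 hadj
        refine mem_biUnion (x := w) ⟨hadj, by omega⟩ ⟨hwu, by omega⟩
    refine Set.Finite.subset ?_ hsub
    refine (finite_singleton v).union (((hfin v).subset (sep_subset _ _)).biUnion ?_)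
    rintro w ⟨hw, hd⟩
    by_contra hinf
    exact hne w hw hd ⟨hv.trans hw.reachable, hinf⟩
  have hρ : Big ρ := by
    refine ⟨SimpleGraph.Reachable.refl ρ, hinf.mono fun u hu => ⟨hu, ?_⟩⟩
    simp
  choose nx hadj hdist hbig using step
  let ks : ℕ → {v // Big v} := Nat.rec ⟨ρ, hρ⟩ fun _ v => ⟨nx v.1 v.2, hbig v.1 v.2⟩
  refine ⟨fun n => (ks n).1, rfl, fun n => hadj (ks n).1 (ks n).2, fun n => ?_⟩
  induction n with
  | zero => exact SimpleGraph.dist_self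
  | succ n ih => exact (hdist (ks n).1 (ks n).2).trans (congrArg (· + 1) ih)

variable {G : SimpleGraph V} {ρ : V}

theorem openGraph_le (x : G.edgeSet → Bool) : openGraph G x ≤ G := by
  intro a b h
  rw [openGraph, SimpleGraph.fromEdgeSet_adj] at h
  exact h.1.1

theorem openGraph_adj_iff (v : Boundary G ρ) (x : G.edgeSet → Bool) (k : ℕ) :
    (openGraph G x).Adj (v.vertex k) (v.vertex (k + 1)) ↔ x (v.edge k) = true := by
  rw [openGraph, SimpleGraph.fromEdgeSet_adj]
  constructor
  · rintro ⟨⟨_, h⟩, -⟩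
    exact h
  · exact fun h => ⟨⟨v.adj k, h⟩, (v.adj k).ne⟩

/-- Some ray has its first `n` edges open. -/
def OpenTo (G : SimpleGraph V) (ρ : V) (n : ℕ) (x : G.edgeSet → Bool) : Prop :=
  ∃ v : Boundary G ρ, ∀ k < n, x (v.edge k) = true

theorem OpenTo.anti {m n : ℕ} (hmn : m ≤ n) {x : G.edgeSet → Bool} (h : OpenTo G ρ n x) :
    OpenTo G ρ m x :=
  let ⟨v, hv⟩ := h
  ⟨v, fun k hk => hv k (lt_of_lt_of_le hk hmn)⟩

theorem OpenTo.mono {n : ℕ} {x y : G.edgeSet → Bool} (hxy : ∀ e, x e = true → y e = true)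
    (h : OpenTo G ρ n x) : OpenTo G ρ n y :=
  let ⟨v, hv⟩ := h
  ⟨v, fun k hk => hxy _ (hv k hk)⟩

theorem Percolates.openTo (hfin : ∀ v, (G.neighborSet v).Finite) {x : G.edgeSet → Bool}
    (h : Percolates G ρ x) (n : ℕ) : OpenTo G ρ n x := by
  obtain ⟨f, h0, hadj, hdist⟩ := exists_geodesic_ray (openGraph G x)
    (fun v => (hfin v).subset fun w hw => openGraph_le x hw) ρ h
  let v : Boundary G ρ :=
    { vertex := f
      start := h0
      adj := fun n => openGraph_le x (hadj n)
      injective := fun k l hkl => by rw [← hdist k, ← hdist l, hkl] }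
  exact ⟨v, fun k _ => (openGraph_adj_iff v x k).1 (hadj k)⟩

theorem percolates_of_forall_openTo {x : G.edgeSet → Bool} (h : ∀ n, OpenTo G ρ n x) :
    Percolates G ρ x := by
  intro hfinite
  -- A segment with as many edges as the cluster has vertices visits one vertex too many.
  obtain ⟨v, hv⟩ := h hfinite.toFinset.card
  have hreach : ∀ k ≤ hfinite.toFinset.card, (openGraph G x).Reachable ρ (v.vertex k) := by
    intro k
    induction k with
    | zero => intro _; rw [v.start]
    | succ k ih =>
      intro hk
      exact (ih (by omega)).trans ((openGraph_adj_iff v x k).2 (hv k hk)).reachable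
  have hcard : ((Finset.range (hfinite.toFinset.card + 1)).map ⟨v.vertex, v.injective⟩).card ≤
      hfinite.toFinset.card := by
    refine Finset.card_le_card fun u hu => ?_
    simp only [Finset.mem_map, Finset.mem_range, Function.Embedding.coeFn_mk] at hu
    obtain ⟨k, hk, rfl⟩ := hu
    exact hfinite.mem_toFinset.2 (hreach k (by omega))
  simp at hcard

end Koenig

/-! ### Finite-dimensional laws of a single edge and the Markov property in both time directions. -/

section Chain

variable {Ω : Type*} [MeasurableSpace Ω] {P : Measure Ω} [IsProbabilityMeasure P] {p : ℝ}

open Classical in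
/-- The probability of an event that depends on a finite-valued variable. -/
theorem sum_measureReal_fiber {C : Type*} [Fintype C] {f : Ω → C}
    (hf : ∀ c, MeasurableSet {ω | f ω = c}) (B : C → Prop) :
    ∑ c, (if B c then P.real {ω | f ω = c} else 0) = P.real {ω | B (f ω)} := by
  have h1 : {ω | B (f ω)} = ⋃ c ∈ Finset.univ.filter B, {ω | f ω = c} := by
    ext ω
    simp
  rw [h1, measureReal_biUnion_finset _ fun c _ => hf c, Finset.sum_filter]
  intro c _ d _ hcd
  refine Set.disjoint_left.2 fun ω hc hd => hcd ?_
  exact (show f ω = c from hc).symm.trans hd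

theorem edgeProb_nonneg (hp : p ∈ Ioo (0 : ℝ) 1) (b : Bool) : 0 ≤ edgeProb p b := by
  cases b
  · exact sub_nonneg.2 hp.2.le
  · exact hp.1.le

theorem transition_nonneg (hp : p ∈ Ioo (0 : ℝ) 1) {t : ℝ} (ht : 0 ≤ t) (i j : Bool) :
    0 ≤ transition p t i j := by
  rw [transition_apply]
  have h1 : Real.exp (-t) ≤ 1 := Real.exp_le_one_iff.2 (by linarith)
  have h2 := (Real.exp_pos (-t)).le
  have h3 := edgeProb_nonneg hp j
  split_ifs
  · nlinarith
  · nlinarith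

/-- Reversibility of the edge chain. -/
theorem edgeProb_mul_transition (t : ℝ) (i j : Bool) :
    edgeProb p i * transition p t i j = edgeProb p j * transition p t j i := by
  rw [transition_apply, transition_apply]
  by_cases h : i = j
  · rw [h]
  · rw [if_neg h, if_neg (Ne.symm h)]
    ring

/-- The probability that the edge chain is in the states `x` at the times `t`. -/
noncomputable def pathWeight (p : ℝ) {m : ℕ} (t : Fin (m + 1) → ℝ≥0) (x : Fin (m + 1) → Bool) : ℝ :=
  edgeProb p (x 0) *
    ∏ i : Fin m, transition p ((t i.succ : ℝ) - (t i.castSucc : ℝ)) (x i.castSucc) (x i.succ)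

theorem pathWeight_nonneg (hp : p ∈ Ioo (0 : ℝ) 1) {m : ℕ} {t : Fin (m + 1) → ℝ≥0}
    (ht : Monotone t) (x : Fin (m + 1) → Bool) : 0 ≤ pathWeight p t x :=
  mul_nonneg (edgeProb_nonneg hp _) (Finset.prod_nonneg fun i _ =>
    transition_nonneg hp (sub_nonneg.2 (ht (Fin.castSucc_lt_succ (i := i)).le)) _ _)

theorem pathWeight_snoc {m : ℕ} (t : Fin (m + 1) → ℝ≥0) (s : ℝ≥0) (x : Fin (m + 1) → Bool)
    (b : Bool) :
    pathWeight p (Fin.snoc t s : Fin (m + 1 + 1) → ℝ≥0) (Fin.snoc x b : Fin (m + 1 + 1) → Bool) =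
      pathWeight p t x * transition p ((s : ℝ) - t (Fin.last m)) (x (Fin.last m)) b := by
  rw [pathWeight, pathWeight, Fin.prod_univ_castSucc, mul_assoc]
  have h0 : (0 : Fin (m + 1 + 1)) = Fin.castSucc 0 := rfl
  rw [h0, Fin.snoc_castSucc]
  congr 2
  · refine Finset.prod_congr rfl fun i _ => ?_
    rw [Fin.succ_castSucc]
    simp only [Fin.snoc_castSucc]
  · rw [Fin.succ_last]
    simp only [Fin.snoc_castSucc, Fin.snoc_last]

/-- Reversibility moves the stationary law from the new first state to the old one, so prepending a
time looks like appending one. -/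
theorem pathWeight_cons {m : ℕ} (t : Fin (m + 1) → ℝ≥0) (s : ℝ≥0) (x : Fin (m + 1) → Bool)
    (b : Bool) :
    pathWeight p (Fin.cons s t : Fin (m + 1 + 1) → ℝ≥0) (Fin.cons b x : Fin (m + 1 + 1) → Bool) =
      pathWeight p t x * transition p ((t 0 : ℝ) - s) (x 0) b := by
  rw [pathWeight, pathWeight, Fin.prod_univ_succ]
  simp only [Fin.castSucc_zero, Fin.cons_zero, Fin.cons_succ, ← Fin.succ_castSucc]
  rw [← mul_assoc, edgeProb_mul_transition]
  ring

variable {Y : ℝ≥0 → Ω → Bool}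

omit [IsProbabilityMeasure P] in
theorem IsStationaryEdgeChain.measureReal (hY : IsStationaryEdgeChain P p Y)
    (hp : p ∈ Ioo (0 : ℝ) 1) {m : ℕ} {t : Fin (m + 1) → ℝ≥0} (ht : Monotone t)
    (x : Fin (m + 1) → Bool) : P.real {ω | ∀ i, Y (t i) ω = x i} = pathWeight p t x := by
  rw [measureReal_def, hY.2 m t ht x]
  exact ENNReal.toReal_ofReal (pathWeight_nonneg hp ht x)

theorem monotone_snoc {m : ℕ} {t : Fin (m + 1) → ℝ≥0} (ht : Monotone t) {s : ℝ≥0}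
    (hs : t (Fin.last m) ≤ s) : Monotone (Fin.snoc t s : Fin (m + 1 + 1) → ℝ≥0) := by
  refine Fin.monotone_iff_le_succ.2 fun i => ?_
  induction i using Fin.lastCases with
  | last => rw [Fin.succ_last, Fin.snoc_castSucc, Fin.snoc_last]; exact hs
  | cast i =>
    rw [Fin.succ_castSucc, Fin.snoc_castSucc, Fin.snoc_castSucc]
    exact ht (Fin.castSucc_lt_succ (i := i)).le

theorem monotone_cons {m : ℕ} {t : Fin (m + 1) → ℝ≥0} (ht : Monotone t) {s : ℝ≥0}
    (hs : s ≤ t 0) : Monotone (Fin.cons s t : Fin (m + 1 + 1) → ℝ≥0) := by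
  refine Fin.monotone_iff_le_succ.2 fun i => ?_
  induction i using Fin.cases with
  | zero => simpa using hs
  | succ i =>
    rw [← Fin.succ_castSucc, Fin.cons_succ, Fin.cons_succ]
    exact ht (Fin.castSucc_lt_succ (i := i)).le

theorem IsStationaryEdgeChain.markov_forward (hY : IsStationaryEdgeChain P p Y)
    (hp : p ∈ Ioo (0 : ℝ) 1) {m : ℕ} {t : Fin (m + 1) → ℝ≥0} (ht : Monotone t) {s : ℝ≥0}
    (hs : t (Fin.last m) ≤ s) (x : Fin (m + 1) → Bool) (b : Bool) :
    P.real {ω | (∀ i, Y (t i) ω = x i) ∧ Y s ω = b} =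
      transition p ((s : ℝ) - t (Fin.last m)) (x (Fin.last m)) b *
        P.real {ω | ∀ i, Y (t i) ω = x i} := by
  have h1 := hY.measureReal hp (monotone_snoc ht hs) (Fin.snoc x b : Fin (m + 1 + 1) → Bool)
  rw [pathWeight_snoc, ← hY.measureReal hp ht, mul_comm] at h1
  rw [← h1]
  congr 1
  ext ω
  simp only [Set.mem_ofPred_eq]
  constructor
  · rintro ⟨h1, h2⟩ i
    induction i using Fin.lastCases with
    | last => simpa using h2
    | cast i => simpa using h1 i
  · intro h
    exact ⟨fun i => by simpa using h i.castSucc, by simpa using h (Fin.last (m + 1))⟩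

theorem IsStationaryEdgeChain.markov_backward (hY : IsStationaryEdgeChain P p Y)
    (hp : p ∈ Ioo (0 : ℝ) 1) {m : ℕ} {t : Fin (m + 1) → ℝ≥0} (ht : Monotone t) {s : ℝ≥0}
    (hs : s ≤ t 0) (x : Fin (m + 1) → Bool) (b : Bool) :
    P.real {ω | (∀ i, Y (t i) ω = x i) ∧ Y s ω = b} =
      transition p ((t 0 : ℝ) - s) (x 0) b * P.real {ω | ∀ i, Y (t i) ω = x i} := by
  have h1 := hY.measureReal hp (monotone_cons ht hs) (Fin.cons b x : Fin (m + 1 + 1) → Bool)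
  rw [pathWeight_cons, ← hY.measureReal hp ht, mul_comm] at h1
  rw [← h1]
  congr 1
  ext ω
  simp only [Set.mem_ofPred_eq]
  constructor
  · rintro ⟨h1, h2⟩ i
    induction i using Fin.cases with
    | zero => simpa using h2
    | succ i => simpa using h1 i
  · intro h
    exact ⟨fun i => by simpa using h i.succ, by simpa using h 0⟩

theorem IsStationaryEdgeChain.measureReal_single (hY : IsStationaryEdgeChain P p Y)
    (hp : p ∈ Ioo (0 : ℝ) 1) (s : ℝ≥0) (b : Bool) : P.real {ω | Y s ω = b} = edgeProb p b := by
  have h1 := hY.measureReal hp (m := 0) (t := fun _ => s) (fun _ _ _ => le_rfl) (fun _ => b)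
  simpa [pathWeight] using h1

theorem IsStationaryEdgeChain.measureReal_pair (hY : IsStationaryEdgeChain P p Y)
    (hp : p ∈ Ioo (0 : ℝ) 1) (s t : ℝ≥0) (b c : Bool) :
    P.real {ω | Y s ω = b ∧ Y t ω = c} = edgeProb p b * transition p |(s : ℝ) - t| b c := by
  have key : ∀ {s t : ℝ≥0}, s ≤ t → ∀ b c,
      P.real {ω | Y s ω = b ∧ Y t ω = c} = edgeProb p b * transition p |(s : ℝ) - t| b c := by
    intro s t hst b c
    have h1 := hY.markov_forward hp (m := 0) (t := fun _ => s) (fun _ _ _ => le_rfl) hst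
      (fun _ => b) c
    simp only [forall_const, hY.measureReal_single hp] at h1
    have h2 : (s : ℝ) ≤ t := hst
    rw [h1, abs_sub_comm, abs_of_nonneg (sub_nonneg.2 h2), mul_comm]
  rcases le_total s t with hst | hst
  · exact key hst b c
  · have h1 := key hst c b
    rw [edgeProb_mul_transition, abs_sub_comm] at h1
    rw [← h1]
    congr 1
    ext ω
    exact and_comm

/-- The normalized indicator that an edge is open. -/
noncomputable def normInd (p : ℝ) (b : Bool) : ℝ := if b then 1 / p else 0

/-- The ratio of the probability that an edge is open at the times `s` and `t` to `p ^ 2`. -/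
noncomputable def openRatio (p : ℝ) (s t : ℝ≥0) : ℝ :=
  1 + (1 - p) / p * Real.exp (-|(s : ℝ) - (t : ℝ)|)

theorem openRatio_eq (hp : p ∈ Ioo (0 : ℝ) 1) (s t : ℝ≥0) :
    openRatio p s t = 1 / p * transition p |(s : ℝ) - t| true true := by
  have := hp.1.ne'
  rw [transition_apply, openRatio]
  simp only [if_true, edgeProb]
  field_simp

/-- All properties but the Markov one follow from the one- and two-time laws; `hq` isolates the only
input that depends on the direction of time. -/
theorem IsStationaryEdgeChain.isPathLaw_aux (hY : IsStationaryEdgeChain P p Y)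
    (hp : p ∈ Ioo (0 : ℝ) 1) {m : ℕ} {t : Fin (m + 1) → ℝ≥0} (ht : Monotone t)
    {q : Fin (m + 1) → Fin (m + 1) → Prop}
    (hq : ∀ j s, q j s → ∀ x : Fin (m + 1) → Bool, x j = true →
      P.real {ω | (∀ k, q k j → Y (t k) ω = x k) ∧ Y (t s) ω = true} =
        transition p |(t j : ℝ) - t s| true true * P.real {ω | ∀ k, q k j → Y (t k) ω = x k}) :
    IsPathLaw (pathWeight p t) (normInd p) (fun j s => openRatio p (t j) (t s)) q := by
  classical
  have hp0 := hp.1.ne'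
  have hm : ∀ y : Fin (m + 1) → Bool, MeasurableSet {ω | (fun j => Y (t j) ω) = y} := fun y =>
    (measurable_pi_lambda _ fun j => hY.1 (t j)) (measurableSet_singleton y)
  have hπ : ∀ y, pathWeight p t y = P.real {ω | (fun j => Y (t j) ω) = y} := by
    intro y
    rw [← hY.measureReal hp ht]
    simp only [funext_iff]
  have hsum : ∀ (B : (Fin (m + 1) → Bool) → Prop) [DecidablePred B],
      ∑ y, (if B y then pathWeight p t y else 0) = P.real {ω | B fun j => Y (t j) ω} := by
    intro B _
    simp only [hπ]
    convert sum_measureReal_fiber (P := P) hm B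
  have hsum' : ∀ (B : (Fin (m + 1) → Bool) → Prop) [DecidablePred B] (s : Fin (m + 1)),
      ∑ y, (if B y then pathWeight p t y * normInd p (y s) else 0) =
        1 / p * P.real {ω | (B fun j => Y (t j) ω) ∧ Y (t s) ω = true} := by
    intro B _ s
    rw [← hsum fun y => B y ∧ y s = true, Finset.mul_sum]
    refine Finset.sum_congr rfl fun y _ => ?_
    rw [normInd]
    by_cases hB : B y <;> by_cases hs : y s = true <;> simp [hB, hs, mul_comm]
  refine ⟨pathWeight_nonneg hp ht, ?_, fun s => ?_, fun s s' => ?_, fun j s hjs x hx => ?_⟩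
  · have := hsum fun _ => True
    simpa using this
  · have h1 := hsum' (fun _ => True) s
    simp only [if_true, true_and] at h1
    rw [h1, hY.measureReal_single hp]
    simp only [edgeProb]
    field_simp
  · have h1 := hsum' (fun y => y s = true) s'
    rw [hY.measureReal_pair hp] at h1
    rw [openRatio_eq hp]
    have h2 : ∑ y, pathWeight p t y * (normInd p (y s) * normInd p (y s')) =
        1 / p * (1 / p * (edgeProb p true * transition p |(t s : ℝ) - t s'| true true)) := by
      rw [← h1, Finset.mul_sum]
      refine Finset.sum_congr rfl fun y _ => ?_
      by_cases hs : y s = true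
      · simp only [hs, normInd, if_true]
        ring
      · simp [hs, normInd]
    rw [h2]
    simp only [edgeProb]
    field_simp
  · have h1 := hsum' (fun y => ∀ k, q k j → y k = x k) s
    rw [hq j s hjs x hx, mul_left_comm, ← mul_assoc, mul_comm (transition _ _ _ _),
      ← openRatio_eq hp, ← hsum fun y => ∀ k, q k j → y k = x k] at h1
    convert h1

theorem IsStationaryEdgeChain.isPathLaw_le (hY : IsStationaryEdgeChain P p Y)
    (hp : p ∈ Ioo (0 : ℝ) 1) {m : ℕ} {t : Fin (m + 1) → ℝ≥0} (ht : Monotone t) :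
    IsPathLaw (pathWeight p t) (normInd p) (fun j s => openRatio p (t j) (t s))
      fun i j => i ≤ j := by
  refine hY.isPathLaw_aux hp ht fun j s hjs x hx => ?_
  have hlt : j.val + 1 ≤ m + 1 := j.2
  let u : Fin (j.val + 1) → Fin (m + 1) := Fin.castLE hlt
  have hu : u (Fin.last j.val) = j := rfl
  have hall : ∀ Q : Fin (m + 1) → Prop, (∀ k, k ≤ j → Q k) ↔ ∀ i, Q (u i) := by
    intro Q
    refine ⟨fun h i => h _ (Fin.le_def.2 (Nat.lt_succ_iff.1 i.2)), fun h k hk => ?_⟩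
    exact h ⟨k.val, Nat.lt_succ_of_le hk⟩
  have h1 := hY.markov_forward hp (t := fun i => t (u i)) (fun a b hab => ht hab) (s := t s)
    (show t j ≤ t s from ht hjs) (fun i => x (u i)) true
  simp only [hu, hx] at h1
  have h2 : (t j : ℝ) ≤ t s := ht hjs
  simp only [hall]
  rw [h1, abs_sub_comm, abs_of_nonneg (sub_nonneg.2 h2)]

theorem IsStationaryEdgeChain.isPathLaw_ge (hY : IsStationaryEdgeChain P p Y)
    (hp : p ∈ Ioo (0 : ℝ) 1) {m : ℕ} {t : Fin (m + 1) → ℝ≥0} (ht : Monotone t) :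
    IsPathLaw (pathWeight p t) (normInd p) (fun j s => openRatio p (t j) (t s))
      fun i j => j ≤ i := by
  refine hY.isPathLaw_aux hp ht fun j s hjs x hx => ?_
  -- The times from `j` on, reindexed to start at zero.
  let u : Fin (m - j.val + 1) → Fin (m + 1) := fun i => ⟨j.val + i.val, by omega⟩
  have hu : u 0 = j := rfl
  have hall : ∀ Q : Fin (m + 1) → Prop, (∀ k, j ≤ k → Q k) ↔ ∀ i, Q (u i) := by
    intro Q
    refine ⟨fun h i => h _ (Fin.le_def.2 (Nat.le_add_right _ _)), fun h k hk => ?_⟩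
    have hk' : j.val ≤ k.val := hk
    have h1 := h ⟨k.val - j.val, by omega⟩
    have h2 : u ⟨k.val - j.val, by omega⟩ = k := Fin.ext (by simp only [u]; omega)
    rwa [h2] at h1
  have h1 := hY.markov_backward hp (t := fun i => t (u i))
    (fun a b hab => ht (Fin.le_def.2 (Nat.add_le_add_left hab _))) (s := t s)
    (show t s ≤ t j from ht hjs) (fun i => x (u i)) true
  simp only [hu, hx] at h1
  have h2 : (t s : ℝ) ≤ t j := ht hjs
  simp only [hall]
  rw [h1, abs_of_nonneg (sub_nonneg.2 h2)]

end Chain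

/-! ### The finite estimates applied to dynamical percolation. -/

section Percolation

variable {V Ω : Type*} [MeasurableSpace Ω] {G : SimpleGraph V} {ρ : V} {p : ℝ} {P : Measure Ω}
  [IsProbabilityMeasure P] {X : G.edgeSet → ℝ≥0 → Ω → Bool}

/-- The kernel `h` with the height of the last common vertex cut off at `n`. -/
noncomputable def truncKernel (p : ℝ) (n : ℕ) (x y : Boundary G ρ × ℝ≥0) : ℝ :=
  openRatio p x.2 y.2 ^ Boundary.meetUpTo n x.1 y.1

theorem IsDynamicalPercolation.sysWeight_eq (hX : IsDynamicalPercolation G p P X)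
    (hp : p ∈ Ioo (0 : ℝ) 1) {m : ℕ} {t : Fin (m + 1) → ℝ≥0} (ht : Monotone t)
    (F : Finset G.edgeSet) (c : F → Fin (m + 1) → Bool) :
    sysWeight (pathWeight p t) c = P.real {ω | (fun (e : F) j => X e (t j) ω) = c} := by
  have h1 := (hX.indep.precomp (g := ((↑) : F → G.edgeSet)) Subtype.val_injective)
  have h2 := h1.measure_inter_preimage_eq_mul Finset.univ
    (sets := fun e => {y : ℝ≥0 → Bool | ∀ j, y (t j) = c e j}) fun e _ => by
      simp only [Set.ofPred_forall]
      exact MeasurableSet.iInter fun j =>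
        (measurable_pi_apply (t j) : Measurable fun y : ℝ≥0 → Bool => y (t j))
          (measurableSet_singleton (c e j))
  have h3 : {ω | (fun (e : F) j => X e (t j) ω) = c} =
      ⋂ e ∈ (Finset.univ : Finset F), (fun (ω : Ω) (s : ℝ≥0) => X e s ω) ⁻¹'
        {y : ℝ≥0 → Bool | ∀ j, y (t j) = c e j} := by
    ext ω
    simp [funext_iff]
  rw [h3, measureReal_def, h2, ENNReal.toReal_prod, sysWeight]
  exact Finset.prod_congr rfl fun e _ => ((hX.chain e).measureReal hp ht (c e)).symm

theorem IsDynamicalPercolation.hitWeight_eq [DecidableEq G.edgeSet]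
    (hX : IsDynamicalPercolation G p P X)
    (hp : p ∈ Ioo (0 : ℝ) 1) {m : ℕ} {t : Fin (m + 1) → ℝ≥0} (ht : Monotone t)
    (F : Finset G.edgeSet) {N : ℕ} (path : Fin N → Finset F) :
    hitWeight (pathWeight p t) path =
      P.real {ω | ∃ i j, ∀ e ∈ path i, X e (t j) ω = true} := by
  classical
  have hm : ∀ c : F → Fin (m + 1) → Bool,
      MeasurableSet {ω | (fun (e : F) j => X e (t j) ω) = c} := fun c =>
    (measurable_pi_lambda (fun ω (e : F) j => X e (t j) ω) fun e =>
      measurable_pi_lambda _ fun j => (hX.chain e).1 (t j)) (measurableSet_singleton c)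
  have h1 := sum_measureReal_fiber (P := P) hm (Hit path)
  rw [hitWeight]
  simp only [hX.sysWeight_eq hp ht]
  exact h1

/-- Both bounds for finitely many rays and times. -/
theorem IsDynamicalPercolation.energy_bounds (hX : IsDynamicalPercolation G p P X)
    (hG : G.IsTree) (hp : p ∈ Ioo (0 : ℝ) 1) {m : ℕ} {t : Fin (m + 1) → ℝ≥0} (ht : Monotone t)
    (n : ℕ) {N : ℕ} (ray : Fin N → Boundary G ρ) :
    (∀ a : Fin N → Fin (m + 1) → ℝ, ∑ i, ∑ j, a i j = 1 →
      1 ≤ P.real {ω | ∃ i j, ∀ k < n, X ((ray i).edge k) (t j) ω = true} *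
        ∑ i, ∑ j, ∑ w, ∑ s, a i j * a w s * truncKernel p n (ray i, t j) (ray w, t s)) ∧
    ∀ r : Fin N → Fin N → Prop, (∀ i j, r i j ∨ r j i) → (∀ i j k, r i j → r j k → r i k) →
      (∀ i j k, r i j → r j k →
        ∀ e ∈ (ray i).path n, e ∈ (ray k).path n → e ∈ (ray j).path n) →
      0 < P.real {ω | ∃ i j, ∀ k < n, X ((ray i).edge k) (t j) ω = true} →
      ∃ a : Fin N → Fin (m + 1) → ℝ, (∀ i j, 0 ≤ a i j) ∧ ∑ i, ∑ j, a i j = 1 ∧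
        P.real {ω | ∃ i j, ∀ k < n, X ((ray i).edge k) (t j) ω = true} *
          (∑ i, ∑ j, ∑ w, ∑ s, a i j * a w s * truncKernel p n (ray i, t j) (ray w, t s)) ≤
            256 := by
  classical
  -- Without rays, no weights sum to one and the hitting event is empty; otherwise some ray supplies
  -- an edge, needed below.
  by_cases hN : Nonempty (Fin N)
  swap
  · rw [not_nonempty_iff] at hN
    simp
  obtain ⟨i₀⟩ := hN
  set F : Finset G.edgeSet := Finset.univ.biUnion fun i => (ray i).path n with hF
  let path : Fin N → Finset F := fun i => ((ray i).path n).subtype (· ∈ F)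
  have hsub : ∀ i, (ray i).path n ⊆ F := fun i =>
    Finset.subset_biUnion_of_mem (fun i => (ray i).path n) (Finset.mem_univ i)
  have hmem : ∀ i (e : F), e ∈ path i ↔ (e : G.edgeSet) ∈ (ray i).path n := fun i e => by
    simp [path]
  have hcard : ∀ i w, (path i ∩ path w).card = Boundary.meetUpTo n (ray i) (ray w) := by
    intro i w
    rw [← Boundary.card_path_inter hG, ← Finset.card_map (Function.Embedding.subtype (· ∈ F))]
    congr 1
    ext e
    simp only [Finset.mem_map, Finset.mem_inter, hmem, Function.Embedding.subtype_apply]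
    exact ⟨fun ⟨e', h, he⟩ => he ▸ h, fun h => ⟨⟨e, hsub i h.1⟩, h, rfl⟩⟩
  have hhit : P.real {ω | ∃ i j, ∀ k < n, X ((ray i).edge k) (t j) ω = true} =
      hitWeight (pathWeight p t) path := by
    rw [hX.hitWeight_eq hp ht]
    congr 1
    ext ω
    refine exists_congr fun i => exists_congr fun j => ⟨fun h e he => ?_, fun h k hk => ?_⟩
    · obtain ⟨k, hk, hke⟩ := Boundary.mem_path.1 ((hmem i e).1 he)
      rw [← hke]
      exact h k hk
    · have h1 : (ray i).edge k ∈ (ray i).path n := Boundary.mem_path.2 ⟨k, hk, rfl⟩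
      exact h ⟨(ray i).edge k, hsub i h1⟩ ((hmem i _).2 h1)
  have hen : ∀ a : Fin N → Fin (m + 1) → ℝ,
      ∑ i, ∑ j, ∑ w, ∑ s, a i j * a w s * truncKernel p n (ray i, t j) (ray w, t s) =
        sysEnergy (fun j s => openRatio p (t j) (t s)) path a := by
    intro a
    simp only [sysEnergy, hcard, truncKernel]
  -- All edges have the same law, so any single edge provides it.
  have hL := (hX.chain ((ray i₀).edge 0)).isPathLaw_le hp ht
  have hL' := (hX.chain ((ray i₀).edge 0)).isPathLaw_ge hp ht
  have hp1 : 0 ≤ 1 / p := one_div_nonneg.2 hp.1.le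
  simp only [hen, hhit]
  refine ⟨fun a ha => hL.one_le_hitWeight_mul (by simp [normInd]) path ha,
    fun r rtot rtr btw hpos => ?_⟩
  refine hL.exists_energy_le hL' (fun b => ?_) le_total (fun i j k => le_trans) rtot rtr
    (fun i j k hij hjk e he => ?_) hpos
  · rw [normInd]
    split_ifs
    · exact hp1
    · exact le_rfl
  · obtain ⟨h1, h2⟩ := Finset.mem_inter.1 he
    exact (hmem j e).2 (btw i j k hij hjk e ((hmem i e).1 h1) ((hmem k e).1 h2))

end Percolation

/-! ### The truncated kernels: continuity and convergence to `h`. -/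

section Kernel

variable {V : Type*} {G : SimpleGraph V} {ρ : V} {p : ℝ}

namespace Boundary

theorem meetUpTo_congr {n : ℕ} {v v' w w' : Boundary G ρ}
    (hv : ∀ i ≤ n, v.vertex i = v'.vertex i) (hw : ∀ i ≤ n, w.vertex i = w'.vertex i) :
    meetUpTo n v w = meetUpTo n v' w' := by
  refine eq_of_forall_le_iff fun k => ?_
  rw [le_meetUpTo_iff, le_meetUpTo_iff]
  refine and_congr_right fun hk => forall₂_congr fun i hi => ?_
  rw [hv i (hi.trans hk), hw i (hi.trans hk)]

theorem meetUpTo_mono {m n : ℕ} (hmn : m ≤ n) (v w : Boundary G ρ) :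
    meetUpTo m v w ≤ meetUpTo n v w :=
  let h := le_meetUpTo_iff.1 (le_refl (meetUpTo m v w))
  le_meetUpTo_iff.2 ⟨h.1.trans hmn, h.2⟩

/-- The truncated meeting height depends only on the first vertices of the rays, hence is locally
constant. -/
theorem continuous_meetUpTo (n : ℕ) :
    Continuous fun z : Boundary G ρ × Boundary G ρ => meetUpTo n z.1 z.2 := by
  refine continuous_iff_continuousAt.2 fun z => ?_
  have h1 : ∀ᶠ v in 𝓝 z.1, ∀ i ≤ n, v.vertex i = z.1.vertex i := by
    filter_upwards [Metric.closedBall_mem_nhds z.1 (Real.exp_pos (-n))] with v hv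
    exact dist_le_iff.1 hv
  have h2 : ∀ᶠ v in 𝓝 z.2, ∀ i ≤ n, v.vertex i = z.2.vertex i := by
    filter_upwards [Metric.closedBall_mem_nhds z.2 (Real.exp_pos (-n))] with v hv
    exact dist_le_iff.1 hv
  refine Tendsto.congr' ?_ tendsto_const_nhds
  filter_upwards [continuous_fst.continuousAt.eventually h1,
    continuous_snd.continuousAt.eventually h2] with u hu1 hu2
  exact (meetUpTo_congr hu1 hu2).symm

end Boundary

theorem one_lt_openRatio (hp : p ∈ Ioo (0 : ℝ) 1) (s t : ℝ≥0) : 1 < openRatio p s t := by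
  have : 0 < (1 - p) / p * Real.exp (-|(s : ℝ) - (t : ℝ)|) :=
    mul_pos (div_pos (sub_pos.2 hp.2) hp.1) (Real.exp_pos _)
  rw [openRatio]
  linarith

theorem truncKernel_pos (hp : p ∈ Ioo (0 : ℝ) 1) (n : ℕ) (x y : Boundary G ρ × ℝ≥0) :
    0 < truncKernel p n x y := pow_pos (zero_lt_one.trans (one_lt_openRatio hp _ _)) _

theorem truncKernel_mono (hp : p ∈ Ioo (0 : ℝ) 1) {m n : ℕ} (hmn : m ≤ n)
    (x y : Boundary G ρ × ℝ≥0) : truncKernel p m x y ≤ truncKernel p n x y :=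
  pow_le_pow_right₀ (one_lt_openRatio hp _ _).le (Boundary.meetUpTo_mono hmn _ _)

theorem continuous_openRatio (p : ℝ) : Continuous fun u : ℝ≥0 × ℝ≥0 => openRatio p u.1 u.2 := by
  unfold openRatio
  fun_prop

theorem continuous_pow_of_discrete {A : Type*} [TopologicalSpace A] {f : A → ℝ} {g : A → ℕ}
    (hf : Continuous f) (hg : Continuous g) : Continuous fun z => f z ^ g z := by
  have h : Continuous fun u : ℝ × ℕ => u.1 ^ u.2 := by
    rw [continuous_prod_of_discrete_right]
    exact fun b => continuous_pow b
  exact h.comp (hf.prodMk hg)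

theorem continuous_truncKernel_comp {A : Type*} [TopologicalSpace A] (p : ℝ) (n : ℕ)
    {f g : A → Boundary G ρ × ℝ≥0} (hf : Continuous f) (hg : Continuous g) :
    Continuous fun z => truncKernel p n (f z) (g z) := by
  have h1 : Continuous fun z => openRatio p (f z).2 (g z).2 :=
    (continuous_openRatio p).comp (hf.snd.prodMk hg.snd)
  have h2 : Continuous fun z => Boundary.meetUpTo n (f z).1 (g z).1 := by
    have h3 := (Boundary.continuous_meetUpTo (G := G) (ρ := ρ) n).comp (hf.fst.prodMk hg.fst)
    exact h3
  exact continuous_pow_of_discrete h1 h2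

/-- For distinct rays the truncation is exact from the meeting height on. For equal rays the powers
are unbounded, since the base exceeds one even as `|s - t|` grows. -/
theorem kernelH_eq_iSup (hp : p ∈ Ioo (0 : ℝ) 1) (x y : Boundary G ρ × ℝ≥0) :
    kernelH p x y = ⨆ n, ENNReal.ofReal (truncKernel p n x y) := by
  have h1 := one_lt_openRatio hp x.2 y.2
  have h0 := zero_le_one.trans h1.le
  by_cases htop : Boundary.meetHeight x.1 y.1 = ⊤
  · rw [kernelH, if_pos htop, eq_comm, iSup_eq_top]
    intro b hb
    have h2 : ∀ n, Boundary.meetUpTo n x.1 y.1 = n := by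
      intro n
      rw [Boundary.meetUpTo, htop, min_top_right, ENat.toNat_natCast]
    obtain ⟨n, hn⟩ := pow_unbounded_of_one_lt b.toReal h1
    refine ⟨n, ?_⟩
    rw [truncKernel, h2, ← ENNReal.ofReal_toReal hb.ne]
    exact (ENNReal.ofReal_lt_ofReal_iff_of_nonneg ENNReal.toReal_nonneg).2 hn
  · have hle : ∀ n, Boundary.meetUpTo n x.1 y.1 ≤ (Boundary.meetHeight x.1 y.1).toNat := fun n =>
      ENat.toNat_le_toNat (min_le_right _ _) htop
    have heq : Boundary.meetUpTo (Boundary.meetHeight x.1 y.1).toNat x.1 y.1 =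
        (Boundary.meetHeight x.1 y.1).toNat := by
      rw [Boundary.meetUpTo, ENat.natCast_toNat htop, min_self]
    rw [kernelH, if_neg htop]
    change ENNReal.ofReal (openRatio p x.2 y.2) ^ _ = _
    rw [← ENNReal.ofReal_pow h0]
    refine le_antisymm ?_ (iSup_le fun n => ENNReal.ofReal_le_ofReal ?_)
    · refine le_iSup_of_le (Boundary.meetHeight x.1 y.1).toNat ?_
      rw [truncKernel, heq]
    · exact pow_le_pow_right₀ h1.le (hle n)

/-- The probability measure with finitely many atoms with given weights. -/
theorem exists_probabilityMeasure_atoms {ι J K : Type*} [Fintype ι] [Fintype J]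
    [MeasurableSpace K] {a : ι → J → ℝ} (ha : ∀ i j, 0 ≤ a i j) (hsum : ∑ i, ∑ j, a i j = 1)
    (x : ι → J → K) : ∃ μ : ProbabilityMeasure K, ∀ g : K → ℝ≥0∞, Measurable g →
      ∫⁻ z, g z ∂(μ : Measure K) = ∑ i, ∑ j, ENNReal.ofReal (a i j) * g (x i j) := by
  let μ : Measure K := ∑ i, ∑ j, ENNReal.ofReal (a i j) • Measure.dirac (x i j)
  have h1 : ∀ g : K → ℝ≥0∞, Measurable g →
      ∫⁻ z, g z ∂μ = ∑ i, ∑ j, ENNReal.ofReal (a i j) * g (x i j) := by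
    intro g hg
    simp only [μ, lintegral_finsetSum_measure, lintegral_smul_measure, lintegral_dirac' _ hg,
      smul_eq_mul]
  have h2 : IsProbabilityMeasure μ := by
    refine ⟨?_⟩
    have h3 := h1 (fun _ => 1) measurable_const
    simp only [lintegral_const, one_mul, mul_one] at h3
    rw [h3]
    simp only [← ENNReal.ofReal_sum_of_nonneg fun j _ => ha _ j]
    rw [← ENNReal.ofReal_sum_of_nonneg fun i _ => Finset.sum_nonneg fun j _ => ha i j, hsum,
      ENNReal.ofReal_one]
  exact ⟨⟨μ, h2⟩, h1⟩

end Kernel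

/-! ### Countable sets that suffice for limits from the right. -/

section RightDense

/-- Every set of times has a countable subset that is dense for limits from the right. -/
theorem exists_countable_right_dense (D : Set ℝ≥0) : ∃ C ⊆ D, C.Countable ∧
    ∀ t ∈ D, ∃ᶠ c in 𝓝[≥] t, c ∈ C := by
  obtain ⟨C₂, hC₂, hC₂D⟩ := TopologicalSpace.exists_countable_dense D
  -- Points of `D` isolated from the right are countable in number and included outright; at any
  -- other point, a countable dense subset of `D` has points arbitrarily close on the right.
  refine ⟨{t ∈ D | 𝓝[D ∩ Ioi t] t = ⊥} ∪ (↑) '' C₂, ?_,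
    (countable_setOfPred_isolated_right_within (s := D)).union (hC₂.image _), fun t ht => ?_⟩
  · rintro t (ht | ⟨u, -, rfl⟩)
    · exact ht.1
    · exact u.2
  · by_cases hiso : 𝓝[D ∩ Ioi t] t = ⊥
    · exact frequently_iff.2 fun hU => ⟨t, mem_of_mem_nhdsWithin self_mem_Ici hU, Or.inl ⟨ht, hiso⟩⟩
    · refine frequently_iff.2 fun {U} hU => ?_
      obtain ⟨O, hO, htO, hOU⟩ := mem_nhdsWithin.1 hU
      have hne : (𝓝[D ∩ Ioi t] t).NeBot := ⟨hiso⟩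
      have h1 : (O ∩ (D ∩ Ioi t)).Nonempty :=
        hne.nonempty_of_mem (inter_mem (mem_nhdsWithin_of_mem_nhds (hO.mem_nhds htO))
          self_mem_nhdsWithin)
      obtain ⟨u, huO, huD, hut⟩ := h1
      have hopen : IsOpen ((↑) ⁻¹' (O ∩ Ioi t) : Set D) :=
        (hO.inter isOpen_Ioi).preimage continuous_subtype_val
      obtain ⟨c, hc, hcC⟩ := hC₂D.inter_open_nonempty _ hopen ⟨⟨u, huD⟩, huO, hut⟩
      exact ⟨c, hOU ⟨hc.1, (mem_Ioi.1 hc.2).le⟩, Or.inr ⟨c, hcC, rfl⟩⟩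

end RightDense

/-! ### Percolation implies positive capacity. -/

section Upper

variable {V Ω : Type*} [MeasurableSpace Ω] {G : SimpleGraph V} {ρ : V} {p : ℝ} {P : Measure Ω}
  [IsProbabilityMeasure P] {X : G.edgeSet → ℝ≥0 → Ω → Bool}

theorem IsCadlagPath.eventually_eq {y : ℝ≥0 → Bool} (hy : IsCadlagPath y) (t : ℝ≥0) :
    ∀ᶠ s in 𝓝[≥] t, y s = y t :=
  (hy t).1.eventually ((isOpen_discrete {y t}).mem_nhds rfl)

theorem exists_monotone_enumeration (T : Finset ℝ≥0) (hT : T.Nonempty) :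
    ∃ (m : ℕ) (t : Fin (m + 1) → ℝ≥0), Monotone t ∧ ∀ s, s ∈ T ↔ ∃ j, t j = s := by
  have hm : T.card = T.card - 1 + 1 := by
    have := hT.card_pos
    omega
  refine ⟨T.card - 1, T.orderEmbOfFin hm, (T.orderEmbOfFin hm).monotone, fun s => ?_⟩
  have h := T.range_orderEmbOfFin hm
  rw [← Finset.mem_coe, ← h]
  exact Iff.rfl

omit [IsProbabilityMeasure P] in
/-- Percolation at some time in `D` is witnessed, at each level, by finitely many times in `D`. -/
theorem IsDynamicalPercolation.exists_times (hX : IsDynamicalPercolation G p P X)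
    (hfin : ∀ v, (G.neighborSet v).Finite) {D : Set ℝ≥0} {η : ℝ≥0∞}
    (hη : η < P {ω | ∃ t ∈ D, Percolates G ρ fun e => X e t ω}) (n : ℕ) {N : ℕ}
    {ray : Fin N → Boundary G ρ}
    (hcov : ∀ v : Boundary G ρ, ∃ i, ∀ k ≤ n, v.vertex k = (ray i).vertex k) :
    ∃ (m : ℕ) (t : Fin (m + 1) → ℝ≥0), Monotone t ∧ (∀ j, t j ∈ D) ∧
      η < P {ω | ∃ i j, ∀ k < n, X ((ray i).edge k) (t j) ω = true} := by
  classical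
  obtain ⟨C, hCD, hC, hdense⟩ := exists_countable_right_dense D
  let A : ℝ≥0 → Set Ω := fun c => {ω | ∃ i, ∀ k < n, X ((ray i).edge k) c ω = true}
  have h1 : P {ω | ∃ t ∈ D, Percolates G ρ fun e => X e t ω} ≤ P (⋃ c ∈ C, A c) := by
    refine measure_mono_ae ?_
    filter_upwards [hX.cadlag] with ω hω
    rintro ⟨t, htD, hperc⟩
    obtain ⟨v, hv⟩ := hperc.openTo hfin n
    obtain ⟨i, hi⟩ := hcov v
    -- By right-continuity in a discrete space, finitely many edges keep their states for a moment
    -- after `t`, long enough to meet `C`.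
    have hev : ∀ᶠ s in 𝓝[≥] t, ∀ k ∈ Finset.range n,
        X ((ray i).edge k) s ω = X ((ray i).edge k) t ω :=
      (Finset.eventually_all _).2 fun k _ => (hω _).eventually_eq t
    obtain ⟨c, hcC, hc⟩ := ((hdense t htD).and_eventually hev).exists
    refine mem_biUnion hcC ⟨i, fun k hk => ?_⟩
    rw [hc k (Finset.mem_range.2 hk), ← Boundary.path_eq_of_agree hi hk]
    exact hv k hk
  have h2 := hη.trans_le h1
  have hCne : C.Nonempty := by
    by_contra hne
    rw [not_nonempty_iff_eq_empty] at hne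
    simp [hne] at h2
  obtain ⟨u, rfl⟩ := hC.exists_eq_range hCne
  -- Continuity from below along an enumeration of `C` leaves finitely many times; this is why `η`
  -- is strictly smaller.
  rw [biUnion_range, measure_iUnion_eq_iSup_accumulate, lt_iSup_iff] at h2
  obtain ⟨k, hk⟩ := h2
  obtain ⟨m, t, htm, ht⟩ := exists_monotone_enumeration ((Finset.range (k + 1)).image u)
    ⟨u 0, Finset.mem_image_of_mem u (by simp)⟩
  refine ⟨m, t, htm, fun j => ?_, hk.trans_le (measure_mono fun ω hω => ?_)⟩
  · obtain ⟨l, -, hl⟩ := Finset.mem_image.1 ((ht (t j)).2 ⟨j, rfl⟩)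
    exact hl ▸ hCD (mem_range_self l)
  · obtain ⟨l, hl, i, hi⟩ := mem_accumulate.1 hω
    obtain ⟨j, hj⟩ := (ht (u l)).1 (Finset.mem_image_of_mem u (Finset.mem_range.2 (by omega)))
    exact ⟨i, j, by rw [hj]; exact hi⟩

/-- At each level there is a probability measure whose energy is bounded in terms of the probability
of percolation at some time in `D`. -/
theorem IsDynamicalPercolation.exists_measure_level (hX : IsDynamicalPercolation G p P X)
    (hG : G.IsTree) (hfin : ∀ v, (G.neighborSet v).Finite) (hp : p ∈ Ioo (0 : ℝ) 1)
    {D : Set ℝ≥0} {η : ℝ} (hη0 : 0 < η)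
    (hη : ENNReal.ofReal η < P {ω | ∃ t ∈ D, Percolates G ρ fun e => X e t ω}) (n : ℕ) :
    ∃ μ : ProbabilityMeasure (Boundary G ρ × D),
      ∫⁻ x, ∫⁻ y, ENNReal.ofReal (truncKernel p n (x.1, (x.2 : ℝ≥0)) (y.1, (y.2 : ℝ≥0)))
        ∂(μ : Measure (Boundary G ρ × D)) ∂(μ : Measure (Boundary G ρ × D)) ≤
          ENNReal.ofReal (256 / η) := by
  have := Boundary.compactSpace (ρ := ρ) hG hfin
  obtain ⟨N, ray, r, hcov, rtot, rtr, btw⟩ := Boundary.exists_ordered_family hG hfin ρ n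
  obtain ⟨m, t, htm, htD, hlt⟩ := hX.exists_times hfin hη n hcov
  set H : Set Ω := {ω | ∃ i j, ∀ k < n, X ((ray i).edge k) (t j) ω = true}
  have hHη : η < P.real H := by
    rw [measureReal_def]
    exact (ENNReal.ofReal_lt_iff_lt_toReal hη0.le (measure_ne_top _ _)).1 hlt
  obtain ⟨a, ha0, hasum, haE⟩ := (hX.energy_bounds hG hp htm n ray).2 r rtot rtr btw
    (hη0.trans hHη)
  obtain ⟨μ, hμ⟩ := exists_probabilityMeasure_atoms ha0 hasum
    fun i j => ((ray i, ⟨t j, htD j⟩) : Boundary G ρ × D)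
  refine ⟨μ, ?_⟩
  have hval : Continuous fun x : Boundary G ρ × D => ((x.1, (x.2 : ℝ≥0)) : Boundary G ρ × ℝ≥0) :=
    continuous_fst.prodMk (continuous_subtype_val.comp continuous_snd)
  have hmy : ∀ x : Boundary G ρ × ℝ≥0, Measurable fun y : Boundary G ρ × D =>
      ENNReal.ofReal (truncKernel p n x (y.1, (y.2 : ℝ≥0))) := fun x =>
    (ENNReal.continuous_ofReal.comp
      (continuous_truncKernel_comp p n continuous_const hval)).measurable
  have hmx : ∀ y : Boundary G ρ × ℝ≥0, Measurable fun x : Boundary G ρ × D =>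
      ENNReal.ofReal (truncKernel p n (x.1, (x.2 : ℝ≥0)) y) := fun x =>
    (ENNReal.continuous_ofReal.comp
      (continuous_truncKernel_comp p n hval continuous_const)).measurable
  have h1 : ∀ x : Boundary G ρ × ℝ≥0, ∫⁻ y, ENNReal.ofReal (truncKernel p n x (y.1, (y.2 : ℝ≥0)))
      ∂(μ : Measure (Boundary G ρ × D)) =
        ∑ w, ∑ s, ENNReal.ofReal (a w s) * ENNReal.ofReal (truncKernel p n x (ray w, t s)) :=
    fun x => hμ _ (hmy x)
  simp only [h1]
  rw [hμ _ (Finset.measurable_sum _ fun w _ => Finset.measurable_sum _ fun s _ =>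
    (hmx (ray w, t s)).const_mul _)]
  have h2 : ∀ i j w s, 0 ≤ a i j * a w s * truncKernel p n (ray i, t j) (ray w, t s) :=
    fun i j w s => mul_nonneg (mul_nonneg (ha0 i j) (ha0 w s)) (truncKernel_pos hp _ _ _).le
  have h3 : ∑ i, ∑ j, ENNReal.ofReal (a i j) *
        ∑ w, ∑ s, ENNReal.ofReal (a w s) *
          ENNReal.ofReal (truncKernel p n (ray i, t j) (ray w, t s)) =
      ENNReal.ofReal
        (∑ i, ∑ j, ∑ w, ∑ s, a i j * a w s * truncKernel p n (ray i, t j) (ray w, t s)) := by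
    rw [ENNReal.ofReal_sum_of_nonneg fun i _ => Finset.sum_nonneg fun j _ =>
      Finset.sum_nonneg fun w _ => Finset.sum_nonneg fun s _ => h2 i j w s]
    refine Finset.sum_congr rfl fun i _ => ?_
    rw [ENNReal.ofReal_sum_of_nonneg fun j _ =>
      Finset.sum_nonneg fun w _ => Finset.sum_nonneg fun s _ => h2 i j w s]
    refine Finset.sum_congr rfl fun j _ => ?_
    rw [ENNReal.ofReal_sum_of_nonneg fun w _ => Finset.sum_nonneg fun s _ => h2 i j w s,
      Finset.mul_sum]
    refine Finset.sum_congr rfl fun w _ => ?_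
    rw [ENNReal.ofReal_sum_of_nonneg fun s _ => h2 i j w s, Finset.mul_sum]
    refine Finset.sum_congr rfl fun s _ => ?_
    rw [ENNReal.ofReal_mul (mul_nonneg (ha0 i j) (ha0 w s)), ENNReal.ofReal_mul (ha0 i j),
      mul_assoc]
  refine h3.le.trans (ENNReal.ofReal_le_ofReal ?_)
  rw [le_div_iff₀ hη0, mul_comm]
  refine le_trans (mul_le_mul_of_nonneg_right hHη.le ?_) haE
  exact Finset.sum_nonneg fun i _ => Finset.sum_nonneg fun j _ =>
      Finset.sum_nonneg fun w _ => Finset.sum_nonneg fun s _ => h2 i j w s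

/-- Compactness of the boundary gives second countability, so the product σ-algebra is the Borel one
and continuity suffices. -/
theorem measurable_truncKernel (hG : G.IsTree) (hfin : ∀ v, (G.neighborSet v).Finite) (p : ℝ)
    (n : ℕ) : Measurable fun z : (Boundary G ρ × ℝ≥0) × (Boundary G ρ × ℝ≥0) =>
      ENNReal.ofReal (truncKernel p n z.1 z.2) := by
  have := Boundary.compactSpace (ρ := ρ) hG hfin
  exact (ENNReal.continuous_ofReal.comp
    (continuous_truncKernel_comp p n continuous_fst continuous_snd)).measurable

/-- If percolation occurs at some time in `D` with positive probability, then some probability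
measure on `∂G × D` has finite energy. -/
theorem IsDynamicalPercolation.capacity_pos (hX : IsDynamicalPercolation G p P X)
    (hG : G.IsTree) (hfin : ∀ v, (G.neighborSet v).Finite) (hp : p ∈ Ioo (0 : ℝ) 1)
    {D : Set ℝ≥0} (hD : IsCompact D)
    (hpos : 0 < P {ω | ∃ t ∈ D, Percolates G ρ fun e => X e t ω}) :
    0 < capacity (kernelH (G := G) (ρ := ρ) p) (univ ×ˢ D) := by
  have := Boundary.compactSpace (ρ := ρ) hG hfin
  have : CompactSpace D := isCompact_iff_compactSpace.1 hD
  obtain ⟨η, hη0, hη⟩ : ∃ η : ℝ, 0 < η ∧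
      ENNReal.ofReal η < P {ω | ∃ t ∈ D, Percolates G ρ fun e => X e t ω} := by
    obtain ⟨q, hq0, hq⟩ := ENNReal.lt_iff_exists_real_btwn.1 hpos
    exact ⟨q, ENNReal.ofReal_pos.1 hq.1, hq.2⟩
  set M := ENNReal.ofReal (256 / η)
  let K := Boundary G ρ × D
  let val : K → Boundary G ρ × ℝ≥0 := fun x => (x.1, (x.2 : ℝ≥0))
  have hval : Continuous val :=
    continuous_fst.prodMk (continuous_subtype_val.comp continuous_snd)
  choose μs hμs using fun n => hX.exists_measure_level hG hfin hp hη0 hη n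
  let U : Ultrafilter ℕ := hyperfilter ℕ
  -- Probability measures on the compact space `K` form a compact space, so the limit along an
  -- ultrafilter exists; products of the measures converge too.
  let μ : ProbabilityMeasure K := (U.map μs).lim
  have hlim : Tendsto μs U (𝓝 μ) := (U.map μs).le_nhds_lim
  have hprod : Tendsto (fun n => (μs n).prod (μs n)) U (𝓝 (μ.prod μ)) :=
    (ProbabilityMeasure.continuous_prod.tendsto (μ, μ)).comp (hlim.prodMk_nhds hlim)
  have hcont : ∀ m, Continuous fun z : K × K => (truncKernel p m (val z.1) (val z.2)).toNNReal :=
    fun m => continuous_real_toNNReal.comp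
      (continuous_truncKernel_comp p m (hval.comp continuous_fst) (hval.comp continuous_snd))
  have hmeas : ∀ m, Measurable fun z : K × K => ENNReal.ofReal (truncKernel p m (val z.1) (val z.2)) :=
    fun m => (ENNReal.continuous_ofReal.comp (continuous_truncKernel_comp p m
      (hval.comp continuous_fst) (hval.comp continuous_snd))).measurable
  -- The level `m` is fixed and its kernel is continuous, so weak convergence applies; for `n ≥ m`
  -- it lies below the kernel of level `n`, whose energy is bounded.
  have hbound : ∀ m, ∫⁻ z, ENNReal.ofReal (truncKernel p m (val z.1) (val z.2))
      ∂((μ.prod μ : ProbabilityMeasure (K × K)) : Measure (K × K)) ≤ M := by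
    intro m
    have h1 := ProbabilityMeasure.tendsto_iff_forall_lintegral_tendsto.1 hprod
      (BoundedContinuousFunction.mkOfCompact ⟨_, hcont m⟩)
    refine le_of_tendsto h1 ?_
    have h2 : ∀ᶠ n in (U : Filter ℕ), m ≤ n :=
      (Nat.hyperfilter_le_atTop : (U : Filter ℕ) ≤ atTop) (eventually_ge_atTop m)
    filter_upwards [h2] with n hn
    have h3 : ∫⁻ z, ENNReal.ofReal (truncKernel p n (val z.1) (val z.2))
        ∂(((μs n).prod (μs n) : ProbabilityMeasure (K × K)) : Measure (K × K)) ≤ M := by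
      refine le_trans (le_of_eq ?_) (hμs n)
      rw [ProbabilityMeasure.toMeasure_prod, lintegral_prod _ (hmeas n).aemeasurable]
    refine le_trans (lintegral_mono fun z => ?_) h3
    exact ENNReal.ofReal_le_ofReal (truncKernel_mono hp hn _ _)
  have hsup : ∫⁻ z, kernelH p (val z.1) (val z.2)
      ∂((μ.prod μ : ProbabilityMeasure (K × K)) : Measure (K × K)) ≤ M := by
    simp only [kernelH_eq_iSup hp]
    rw [lintegral_iSup hmeas]
    · exact iSup_le hbound
    · intro m n hmn z
      exact ENNReal.ofReal_le_ofReal (truncKernel_mono hp hmn _ _)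
  let ν : Measure (Boundary G ρ × ℝ≥0) := (μ : Measure K).map val
  have hν : IsProbabilityMeasure ν := Measure.isProbabilityMeasure_map hval.measurable.aemeasurable
  have hνD : ν (univ ×ˢ D)ᶜ = 0 := by
    rw [Measure.map_apply hval.measurable (MeasurableSet.univ.prod hD.measurableSet).compl]
    have : val ⁻¹' (univ ×ˢ D)ᶜ = ∅ := by
      ext x
      simp [val]
    rw [this, measure_empty]
  have hkm : Measurable fun z : (Boundary G ρ × ℝ≥0) × (Boundary G ρ × ℝ≥0) =>
      kernelH p z.1 z.2 := by
    simp only [kernelH_eq_iSup hp]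
    exact Measurable.iSup fun n => measurable_truncKernel hG hfin p n
  have hen : energy (kernelH p) ν ≤ M := by
    refine le_trans (le_of_eq ?_) hsup
    rw [energy, ← lintegral_prod (fun z => kernelH p z.1 z.2) hkm.aemeasurable,
      Measure.map_prod_map _ _ hval.measurable hval.measurable,
      lintegral_map hkm (hval.measurable.prodMap hval.measurable)]
    rfl
  rw [capacity, ENNReal.inv_pos]
  refine ne_top_of_le_ne_top ENNReal.ofReal_ne_top (le_trans ?_ hen)
  exact iInf_le_of_le ν (iInf_le_of_le hν (iInf_le_of_le hνD le_rfl))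

end Upper

/-! ### The probability that an edge flips in a short interval. -/

section Flip

variable {Ω : Type*} [MeasurableSpace Ω] {P : Measure Ω} [IsProbabilityMeasure P] {p : ℝ}

/-- The paths that change their value on the dyadic points of `[s, s + h]`. -/
def flipSet (s h : ℝ≥0) : Set (ℝ≥0 → Bool) :=
  ⋃ N : ℕ, {y | ∃ k ≤ 2 ^ N, y (s + h / 2 ^ N * (k : ℕ)) ≠ y s}

theorem measurableSet_ne (s t : ℝ≥0) : MeasurableSet {y : ℝ≥0 → Bool | y s ≠ y t} :=
  (measurableSet_eq_fun (measurable_pi_apply s) (measurable_pi_apply t)).compl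

theorem measurableSet_flipSet (s h : ℝ≥0) : MeasurableSet (flipSet s h) := by
  refine MeasurableSet.iUnion fun N => ?_
  have : {y : ℝ≥0 → Bool | ∃ k ≤ 2 ^ N, y (s + h / 2 ^ N * (k : ℕ)) ≠ y s} =
      ⋃ k ∈ {k : ℕ | k ≤ 2 ^ N}, {y | y (s + h / 2 ^ N * (k : ℕ)) ≠ y s} := by
    ext y
    simp
  rw [this]
  exact MeasurableSet.biUnion (Set.to_countable _) fun k _ => measurableSet_ne _ _

theorem eq_of_notMem_flipSet {y : ℝ≥0 → Bool} (hy : IsCadlagPath y) {s h : ℝ≥0}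
    (hn : y ∉ flipSet s h) {t : ℝ≥0} (hst : s ≤ t) (hth : t ≤ s + h) : y t = y s := by
  have hgrid : ∀ N k : ℕ, k ≤ 2 ^ N → y (s + h / 2 ^ N * (k : ℕ)) = y s := by
    intro N k hk
    by_contra hne
    exact hn (mem_iUnion.2 ⟨N, k, hk, hne⟩)
  rcases eq_or_ne h 0 with rfl | hh
  · rw [add_zero] at hth
    rw [le_antisymm hth hst]
  have hpow : ∀ N : ℕ, (0 : ℝ≥0) < 2 ^ N := fun N => pow_pos two_pos N
  have hh0 : 0 < h := pos_iff_ne_zero.2 hh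
  obtain ⟨u, rfl⟩ := exists_add_of_le hst
  have hu : u ≤ h := by simpa using hth
  -- Rounding up makes the dyadic points approach `s + u` from the right, where the path is
  -- continuous, without leaving the interval.
  let k : ℕ → ℕ := fun N => ⌈u / h * 2 ^ N⌉₊
  have hk : ∀ N, k N ≤ 2 ^ N := by
    intro N
    refine Nat.ceil_le.2 ?_
    push_cast
    exact mul_le_of_le_one_left (hpow N).le ((div_le_one hh0).2 hu)
  have hlow : ∀ N, u ≤ h / 2 ^ N * (k N : ℕ) := by
    intro N
    have h1 : u / h * 2 ^ N ≤ (k N : ℝ≥0) := Nat.le_ceil _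
    calc u = h / 2 ^ N * (u / h * 2 ^ N) := by field_simp [(hpow N).ne']
      _ ≤ _ := mul_le_mul_of_nonneg_left h1 (by positivity)
  have hupp : ∀ N, h / 2 ^ N * (k N : ℕ) ≤ u + h / 2 ^ N := by
    intro N
    have h1 : (k N : ℝ≥0) ≤ u / h * 2 ^ N + 1 := (Nat.ceil_lt_add_one (by positivity)).le
    calc _ ≤ h / 2 ^ N * (u / h * 2 ^ N + 1) := mul_le_mul_of_nonneg_left h1 (by positivity)
      _ = _ := by field_simp [(hpow N).ne']
  have hlim : Tendsto (fun N : ℕ => s + h / 2 ^ N * (k N : ℕ)) atTop (𝓝[≥] (s + u)) := by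
    refine tendsto_nhdsWithin_iff.2 ⟨?_, Eventually.of_forall fun N => ?_⟩
    · refine tendsto_const_nhds.add ?_
      have h0 : Tendsto (fun N : ℕ => u + h / 2 ^ N) atTop (𝓝 u) := by
        have h1 : Tendsto (fun N : ℕ => h * (1 / 2 : ℝ≥0) ^ N) atTop (𝓝 0) := by
          have := (NNReal.tendsto_pow_atTop_nhds_zero_of_lt_one
            (r := (1 / 2 : ℝ≥0)) one_half_lt_one).const_mul h
          simpa using this
        have h2 : (fun N : ℕ => u + h / 2 ^ N) = fun N : ℕ => u + h * (1 / 2 : ℝ≥0) ^ N := by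
          funext N
          rw [one_div, inv_pow, div_eq_mul_inv]
        rw [h2]
        simpa using tendsto_const_nhds.add h1
      exact tendsto_of_tendsto_of_tendsto_of_le_of_le tendsto_const_nhds h0 hlow hupp
    · exact add_le_add_right (hlow N) s
  obtain ⟨N, hN⟩ := (hlim.eventually (hy.eventually_eq (s + u))).exists
  rw [← hN, hgrid N _ (hk N)]

/-- The exact probability is `2 * p * (1 - p) * (1 - exp (-d))`, which is even at most `d / 2`. -/
theorem IsStationaryEdgeChain.measure_ne_le {Y : ℝ≥0 → Ω → Bool}
    (hY : IsStationaryEdgeChain P p Y) (hp : p ∈ Ioo (0 : ℝ) 1) (s d : ℝ≥0) :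
    P {ω | Y s ω ≠ Y (s + d) ω} ≤ d := by
  have h1 : {ω | Y s ω ≠ Y (s + d) ω} ⊆ {ω | Y s ω = true ∧ Y (s + d) ω = false} ∪
      {ω | Y s ω = false ∧ Y (s + d) ω = true} := by
    intro ω hω
    change Y s ω ≠ Y (s + d) ω at hω
    cases h2 : Y s ω <;> cases h3 : Y (s + d) ω <;> simp_all
  have h2 : P.real {ω | Y s ω ≠ Y (s + d) ω} ≤ d := by
    refine (measureReal_mono h1).trans ((measureReal_union_le _ _).trans ?_)
    rw [hY.measureReal_pair hp, hY.measureReal_pair hp, transition_apply, transition_apply]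
    have h3 : |(s : ℝ) - ((s + d : ℝ≥0) : ℝ)| = d := by
      rw [NNReal.coe_add, sub_add_cancel_left, abs_neg]
      exact abs_of_nonneg d.2
    have h4 : 1 - (d : ℝ) ≤ Real.exp (-d) := by
      have := Real.add_one_le_exp (-(d : ℝ))
      linarith
    have h5 : Real.exp (-(d : ℝ)) ≤ 1 := Real.exp_le_one_iff.2 (neg_nonpos.2 d.2)
    rw [h3]
    simp only [edgeProb, Bool.true_eq_false, Bool.false_eq_true, if_false]
    have h6 := hp.1
    have h7 := hp.2
    have h8 : p * (1 - p) ≤ 1 / 4 := by nlinarith [sq_nonneg (p - 1 / 2)]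
    have h9 : 0 ≤ p * (1 - p) := mul_nonneg h6.le (sub_pos.2 h7).le
    nlinarith [d.2]
  rw [measureReal_def] at h2
  rw [← ENNReal.ofReal_coe_nnreal]
  exact ENNReal.le_ofReal_iff_toReal_le (measure_ne_top _ _) d.2 |>.2 h2

theorem IsStationaryEdgeChain.measure_flipSet_le {Y : ℝ≥0 → Ω → Bool}
    (hY : IsStationaryEdgeChain P p Y) (hp : p ∈ Ioo (0 : ℝ) 1) (s h : ℝ≥0) :
    P {ω | (fun t => Y t ω) ∈ flipSet s h} ≤ h := by
  have h1 : {ω | (fun t => Y t ω) ∈ flipSet s h} =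
      ⋃ N : ℕ, {ω | ∃ k ≤ 2 ^ N, Y (s + h / 2 ^ N * (k : ℕ)) ω ≠ Y s ω} := by
    ext ω
    simp [flipSet]
  have hmono : Monotone fun N : ℕ =>
      {ω | ∃ k ≤ 2 ^ N, Y (s + h / 2 ^ N * (k : ℕ)) ω ≠ Y s ω} := by
    refine monotone_nat_of_le_succ fun N => ?_
    rintro ω ⟨k, hk, hne⟩
    refine ⟨2 * k, by rw [pow_succ]; omega, ?_⟩
    have : h / 2 ^ (N + 1) * ((2 * k : ℕ) : ℝ≥0) = h / 2 ^ N * (k : ℕ) := by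
      push_cast
      rw [pow_succ]
      field_simp
    rwa [this]
  rw [h1, hmono.measure_iUnion]
  refine iSup_le fun N => ?_
  -- A change relative to the start forces a change over some mesh interval; the union bound over `2
  -- ^ N` intervals of length `h / 2 ^ N` gives `h` for every `N`.
  have hsub : {ω | ∃ k ≤ 2 ^ N, Y (s + h / 2 ^ N * (k : ℕ)) ω ≠ Y s ω} ⊆
      ⋃ k ∈ Finset.range (2 ^ N), {ω | Y (s + h / 2 ^ N * (k : ℕ)) ω ≠
        Y (s + h / 2 ^ N * (k : ℕ) + h / 2 ^ N) ω} := by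
    rintro ω ⟨k, hk, hne⟩
    by_contra hno
    simp only [mem_iUnion, Finset.mem_range, exists_prop, not_exists, not_and] at hno
    refine hne ?_
    clear hne
    induction k with
    | zero => simp
    | succ k ih =>
      rw [← ih (by omega)]
      have h2 := hno k (by omega)
      rw [mem_ofPred_eq, not_not] at h2
      have h3 : s + h / 2 ^ N * ((k + 1 : ℕ) : ℝ≥0) = s + h / 2 ^ N * (k : ℕ) + h / 2 ^ N := by
        push_cast
        ring
      rw [h2, h3]
  refine (measure_mono hsub).trans ((measure_biUnion_finset_le _ _).trans ?_)
  refine (Finset.sum_le_sum fun k _ => hY.measure_ne_le hp _ _).trans (le_of_eq ?_)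
  rw [Finset.sum_const, Finset.card_range, nsmul_eq_mul]
  norm_cast
  push_cast
  exact mul_div_cancel₀ _ (pow_ne_zero N two_ne_zero)

end Flip

/-! ### From all finite levels to infinity along a fixed realization. -/

section Levels

variable {V : Type*} {G : SimpleGraph V} {ρ : V}

/-- Whether some ray is open up to height `n` depends on finitely many edges. -/
theorem exists_level_edges (hG : G.IsTree) (hfin : ∀ v, (G.neighborSet v).Finite) (ρ : V) (n : ℕ) :
    ∃ F : Finset G.edgeSet, ∀ x y : G.edgeSet → Bool, (∀ e ∈ F, x e = true → y e = true) →
      OpenTo G ρ n x → OpenTo G ρ n y := by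
  classical
  obtain ⟨N, ray, -, hcov, -⟩ := Boundary.exists_ordered_family hG hfin ρ n
  refine ⟨Finset.univ.biUnion fun i => (ray i).path n, fun x y hxy => ?_⟩
  rintro ⟨v, hv⟩
  obtain ⟨i, hi⟩ := hcov v
  refine ⟨v, fun k hk => hxy _ ?_ (hv k hk)⟩
  refine Finset.mem_biUnion.2 ⟨i, Finset.mem_univ i, ?_⟩
  rw [Boundary.path_eq_of_agree hi hk]
  exact Boundary.mem_path.2 ⟨k, hk, rfl⟩

/-- The dichotomy behind the passage to the limit: either there is percolation at some time in `D`,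
or an edge changes its state at a time at which the left limits percolate. -/
theorem percolates_or_exists_flip {F : ℕ → Finset G.edgeSet}
    (hF : ∀ n (x y : G.edgeSet → Bool), (∀ e ∈ F n, x e = true → y e = true) →
      OpenTo G ρ n x → OpenTo G ρ n y)
    {y : G.edgeSet → ℝ≥0 → Bool} (hy : ∀ e, IsCadlagPath (y e)) {D : Set ℝ≥0} (hD : IsCompact D)
    (hopen : ∀ n, ∃ t ∈ D, OpenTo G ρ n fun e => y e t) :
    (∃ t ∈ D, Percolates G ρ fun e => y e t) ∨
      ∃ n, ∃ e ∈ F n, ∃ t ∈ D, 0 < t ∧ ∃ l : G.edgeSet → Bool, l e ≠ y e t ∧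
        (∀ m, OpenTo G ρ m l) ∧ ∀ e', ∀ᶠ s in 𝓝[<] t, y e' s = l e' := by
  choose u huD hu using hopen
  let U : Ultrafilter ℕ := hyperfilter ℕ
  have hUtop : ∀ m, ∀ᶠ n in (U : Filter ℕ), m ≤ n := fun m =>
    (Nat.hyperfilter_le_atTop : (U : Filter ℕ) ≤ atTop) (eventually_ge_atTop m)
  -- The times `u n` at which level `n` is reached converge along the ultrafilter to some `t ∈ D`.
  obtain ⟨t, htD, ht⟩ := hD.ultrafilter_le_nhds (U.map u)
    (le_principal_iff.2 (Eventually.of_forall huD : ∀ᶠ n in (U : Filter ℕ), u n ∈ D))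
  have ht' : Tendsto u U (𝓝 t) := ht
  have transfer : ∀ (W : Filter ℝ≥0) (l : G.edgeSet → Bool), Tendsto u U W →
      (∀ e, ∀ᶠ s in W, y e s = l e) → ∀ m, OpenTo G ρ m l := by
    intro W l hW hl m
    have h1 : ∀ᶠ s in W, ∀ e ∈ F m, y e s = l e := (Finset.eventually_all _).2 fun e _ => hl e
    obtain ⟨n, hn, hmn⟩ := ((hW.eventually h1).and (hUtop m)).exists
    exact hF m _ _ (fun e he hx => hn e he ▸ hx) ((hu n).anti hmn)
  -- If `u n` approaches `t` from the right, right-continuity gives percolation at `t` itself; from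
  -- the left, only the left limits `l` percolate.
  rcases U.eventually_or.1 (Eventually.of_forall fun n => le_or_gt t (u n)) with h | h
  · left
    refine ⟨t, htD, percolates_of_forall_openTo ?_⟩
    exact transfer (𝓝[≥] t) _ (tendsto_nhdsWithin_iff.2 ⟨ht', h⟩) fun e => (hy e).eventually_eq t
  · have hleft : ∀ e, ∃ b, ∀ᶠ s in 𝓝[<] t, y e s = b := by
      intro e
      obtain ⟨b, hb⟩ := (hy e t).2
      exact ⟨b, hb.eventually ((isOpen_discrete {b}).mem_nhds rfl)⟩
    choose l hl using hleft
    have hopenl := transfer (𝓝[<] t) l (tendsto_nhdsWithin_iff.2 ⟨ht', h⟩) hl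
    by_cases hall : ∀ n, ∀ e ∈ F n, l e = y e t
    · exact Or.inl ⟨t, htD, percolates_of_forall_openTo fun n =>
        hF n _ _ (fun e he hx => hall n e he ▸ hx) (hopenl n)⟩
    · push Not at hall
      obtain ⟨n, e, he, hne⟩ := hall
      obtain ⟨k, hk⟩ := h.exists
      exact Or.inr ⟨n, e, he, t, htD, lt_of_le_of_lt zero_le hk, l, hne, hopenl, hl⟩

end Levels

/-! ### No flip at a time when the left limits percolate, absent percolation at a fixed time. -/

section LeftLimit

variable {V Ω : Type*} [MeasurableSpace Ω] {G : SimpleGraph V} {ρ : V} {p : ℝ} {P : Measure Ω}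
  [IsProbabilityMeasure P] {X : G.edgeSet → ℝ≥0 → Ω → Bool}

open Classical in
/-- Extend a configuration on `T` by open edges. -/
noncomputable def fillOpen (T : Finset G.edgeSet) (x : T → Bool) (e : G.edgeSet) : Bool :=
  if h : e ∈ T then x ⟨e, h⟩ else true

omit [IsProbabilityMeasure P] in
theorem IsDynamicalPercolation.measurable_path (hX : IsDynamicalPercolation G p P X)
    (e : G.edgeSet) : Measurable fun ω t => X e t ω :=
  measurable_pi_lambda _ fun t => (hX.chain e).1 t

theorem IsDynamicalPercolation.measure_inter_eq_mul (hX : IsDynamicalPercolation G p P X)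
    {e : G.edgeSet} {T : Finset G.edgeSet} (he : e ∉ T) {A : Set (ℝ≥0 → Bool)}
    (hA : MeasurableSet A) {B : Set (T → ℝ≥0 → Bool)} (hB : MeasurableSet B) :
    P ({ω | (fun t => X e t ω) ∈ A} ∩ {ω | (fun (e' : T) t => X e' t ω) ∈ B}) =
      P {ω | (fun t => X e t ω) ∈ A} * P {ω | (fun (e' : T) t => X e' t ω) ∈ B} := by
  have h1 := hX.indep.indepFun_finset {e} T (Finset.disjoint_singleton_left.2 he)
    hX.measurable_path
  have h2 := h1.comp (measurable_pi_apply (⟨e, Finset.mem_singleton_self e⟩ : ({e} : Finset _)))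
    measurable_id
  exact h2.measure_inter_preimage_eq_mul _ _ hA hB

theorem IsDynamicalPercolation.measureReal_static (hX : IsDynamicalPercolation G p P X)
    (hp : p ∈ Ioo (0 : ℝ) 1) (T : Finset G.edgeSet) (B : Set (T → Bool)) (s s' : ℝ≥0) :
    P.real {ω | (fun e : T => X e s ω) ∈ B} = P.real {ω | (fun e : T => X e s' ω) ∈ B} := by
  classical
  have hm : ∀ (s : ℝ≥0) (c : T → Bool), MeasurableSet {ω | (fun e : T => X e s ω) = c} :=
    fun s c => (measurable_pi_lambda (fun ω (e : T) => X e s ω) fun e => (hX.chain e).1 s)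
      (measurableSet_singleton c)
  have key : ∀ s c, P.real {ω | (fun e : T => X e s ω) = c} = ∏ e, edgeProb p (c e) := by
    intro s c
    have h1 := hX.sysWeight_eq hp (m := 0) (t := fun _ => s) (fun _ _ _ => le_rfl) T
      fun e _ => c e
    have h2 : {ω | (fun (e : T) (_ : Fin (0 + 1)) => X e s ω) = fun e _ => c e} =
        {ω | (fun e : T => X e s ω) = c} := by
      ext ω
      simp [funext_iff]
    rw [h2] at h1
    rw [← h1, sysWeight]
    simp [pathWeight]
  have h1 := fun s => sum_measureReal_fiber (P := P) (hm s) (· ∈ B)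
  rw [← h1, ← h1]
  simp only [key]

/-- The configurations on `T` that, together with the edges outside of `T`, connect the root to
level `m`. -/
def openSet (ρ : V) (m : ℕ) (T : Finset G.edgeSet) : Set (T → Bool) :=
  {x | OpenTo G ρ m (fillOpen T x)}

/-- If the edges of `T` connect once `e` is opened, and `e`, which is independent of them, is indeed
open, then level `m` is reached; requiring this costs the factor `p`. Stationarity allows different
times on the two sides. -/
theorem IsDynamicalPercolation.measureReal_openSet_le (hX : IsDynamicalPercolation G p P X)
    (hp : p ∈ Ioo (0 : ℝ) 1) {m : ℕ} {F : Finset G.edgeSet} {e : G.edgeSet} {T : Finset G.edgeSet}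
    (hT : ∀ e', e' ∈ T ↔ e' ≠ e ∧ e' ∈ F)
    (hF : ∀ (x y : G.edgeSet → Bool), (∀ e ∈ F, x e = true → y e = true) →
      OpenTo G ρ m x → OpenTo G ρ m y) (s s' : ℝ≥0) :
    P.real {ω | (fun e : T => X e s ω) ∈ openSet ρ m T} ≤
      P.real {ω | OpenTo G ρ m fun e => X e s' ω} / p := by
  have heT : e ∉ T := fun h => ((hT e).1 h).1 rfl
  have hAm : MeasurableSet {y : ℝ≥0 → Bool | y s' = true} :=
    (measurable_pi_apply s' : Measurable fun y : ℝ≥0 → Bool => y s') (measurableSet_singleton true)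
  have hBm : MeasurableSet {z : T → ℝ≥0 → Bool | (fun e => z e s') ∈ openSet ρ m T} :=
    (measurable_pi_lambda (fun (z : T → ℝ≥0 → Bool) e => z e s') fun e =>
      (measurable_pi_apply s').comp (measurable_pi_apply e)) (Set.toFinite _).measurableSet
  have h1 := hX.measure_inter_eq_mul heT hAm hBm
  rw [hX.measureReal_static hp T _ s s', le_div_iff₀ hp.1]
  have h2 : P.real {ω | X e s' ω = true} = p := (hX.chain e).measureReal_single hp s' true
  have h3 := congrArg ENNReal.toReal h1
  rw [ENNReal.toReal_mul] at h3
  change P.real _ = P.real {ω | X e s' ω = true} *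
    P.real {ω | (fun e : T => X e s' ω) ∈ openSet ρ m T} at h3
  rw [h2, mul_comm] at h3
  rw [← h3]
  refine measureReal_mono fun ω hω => ?_
  have hω2 : OpenTo G ρ m (fillOpen T fun e' => X e' s' ω) := hω.2
  refine (hF _ (fun e => X e s' ω) (fun e' he' hx => ?_) hω2 : OpenTo G ρ m fun e => X e s' ω)
  by_cases hee : e' = e
  · rw [hee]
    exact hω.1
  · rwa [fillOpen, dif_pos ((hT e').2 ⟨hee, he'⟩)] at hx

/-- The configurations at which `e` changes its state at a time `t ≤ K` at which the left limits
connect the root to infinity. -/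
def flipPerc (ρ : V) (X : G.edgeSet → ℝ≥0 → Ω → Bool) (e : G.edgeSet) (K : ℝ≥0) : Set Ω :=
  {ω | ∃ t, 0 < t ∧ t ≤ K ∧ ∃ l : G.edgeSet → Bool, l e ≠ X e t ω ∧ (∀ m, OpenTo G ρ m l) ∧
    ∀ e', ∀ᶠ s in 𝓝[<] t, X e' s ω = l e'}

/-- Cut `[0, K]` into `N` intervals. In the one that contains `t`, the edge `e` flips, and the other
edges, independently, either have another flip within `F` or already connect at the left endpoint
once `e` is opened. The sum over the intervals of the product of these probabilities is the bound.
-/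
theorem IsDynamicalPercolation.measureReal_flipPerc_le (hX : IsDynamicalPercolation G p P X)
    (hp : p ∈ Ioo (0 : ℝ) 1) {m : ℕ} {F : Finset G.edgeSet}
    (hF : ∀ (x y : G.edgeSet → Bool), (∀ e ∈ F, x e = true → y e = true) →
      OpenTo G ρ m x → OpenTo G ρ m y) (t₀ : ℝ≥0) (e : G.edgeSet) (K : ℝ≥0) {N : ℕ} (hN : 0 < N) :
    P.real (flipPerc ρ X e K) ≤
      K * (P.real {ω | OpenTo G ρ m fun e => X e t₀ ω} / p + F.card * (K / N)) := by
  classical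
  set T := F.erase e with hTdef
  have hT : ∀ e', e' ∈ T ↔ e' ≠ e ∧ e' ∈ F := fun e' => Finset.mem_erase
  have heT : e ∉ T := Finset.notMem_erase e F
  set h : ℝ≥0 := K / N with hh
  let B : ℝ≥0 → Set (T → ℝ≥0 → Bool) := fun s =>
    {z | (fun e => z e s) ∈ openSet ρ m T} ∪ ⋃ e' : T, {z | z e' ∈ flipSet s h}
  have hBm : ∀ s, MeasurableSet (B s) := fun s =>
    ((measurable_pi_lambda (fun (z : T → ℝ≥0 → Bool) e => z e s) fun e =>
      (measurable_pi_apply s).comp (measurable_pi_apply e)) (Set.toFinite _).measurableSet).union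
      (MeasurableSet.iUnion fun e' => (measurable_pi_apply e') (measurableSet_flipSet s h))
  let I : ℕ → Set Ω := fun k => {ω | (fun t => X e t ω) ∈ flipSet (h * k) h} ∩
    {ω | (fun (e' : T) t => X e' t ω) ∈ B (h * k)}
  have hcov : P (flipPerc ρ X e K) ≤ P (⋃ k ∈ Finset.range N, I k) := by
    refine measure_mono_ae ?_
    filter_upwards [hX.cadlag] with ω hω
    rintro ⟨t, ht0, htK, l, hle, hopen, hl⟩
    have hK0 : 0 < K := ht0.trans_le htK
    have hN0 : (0 : ℝ≥0) < N := Nat.cast_pos.2 hN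
    have hh0 : 0 < h := div_pos hK0 hN0
    -- With the ceiling, `t` lies strictly to the right of `h * k`, so the left limits at `t` are
    -- seen within the interval even when `t` is a mesh point.
    obtain ⟨k, hk⟩ : ∃ k, ⌈t / h⌉₊ = k + 1 :=
      Nat.exists_eq_succ_of_ne_zero (Nat.ceil_pos.2 (div_pos ht0 hh0)).ne'
    have hkt : h * k < t := by
      have h1 : (k : ℝ≥0) < t / h := Nat.lt_ceil.1 (by omega)
      rwa [lt_div_iff₀ hh0, mul_comm] at h1
    have htk : t ≤ h * k + h := by
      have h1 : t / h ≤ ((k + 1 : ℕ) : ℝ≥0) := Nat.ceil_le.1 hk.le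
      rw [div_le_iff₀ hh0] at h1
      refine h1.trans_eq ?_
      push_cast
      ring
    have hkN : k < N := by
      have h1 : ⌈t / h⌉₊ ≤ N := by
        refine Nat.ceil_le.2 ((div_le_iff₀ hh0).2 ?_)
        rwa [hh, mul_div_cancel₀ _ hN0.ne']
      omega
    have hleft : ∀ e', (fun t => X e' t ω) ∉ flipSet (h * k) h → l e' = X e' (h * k) ω := by
      intro e' he'
      have h1 : ∀ᶠ s in 𝓝[<] t, s ∈ Ico (h * (k : ℝ≥0)) t := Ico_mem_nhdsLT hkt
      have hne : (𝓝[<] t).NeBot := nhdsLT_neBot_of_exists_lt ⟨_, hkt⟩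
      obtain ⟨s, hs, hsl⟩ := (h1.and (hl e')).exists
      rw [← hsl]
      exact eq_of_notMem_flipSet (hω e') he' hs.1 (hs.2.le.trans htk)
    refine mem_biUnion (Finset.mem_coe.2 (Finset.mem_range.2 hkN)) ⟨?_, ?_⟩
    · by_contra hno
      refine hle ?_
      rw [hleft e hno]
      exact (eq_of_notMem_flipSet (hω e) hno hkt.le htk).symm
    · by_contra hno
      have hno' : ∀ e' : T, (fun t => X e' t ω) ∉ flipSet (h * k) h := fun e' he' =>
        hno (Or.inr (mem_iUnion.2 ⟨e', he'⟩))
      refine hno (Or.inl (hF l _ (fun e' he' hx => ?_) (hopen m)))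
      change fillOpen T (fun e' => X e' (h * k) ω) e' = true
      rw [fillOpen]
      split_ifs with h1
      · rw [← hleft e' (hno' ⟨e', h1⟩)]
        exact hx
      · rfl
  have hIk : ∀ k, P.real (I k) ≤
      h * (P.real {ω | OpenTo G ρ m fun e => X e t₀ ω} / p + F.card * h) := by
    intro k
    have h1 := congrArg ENNReal.toReal
      (hX.measure_inter_eq_mul heT (measurableSet_flipSet (h * k) h) (hBm (h * k)))
    rw [ENNReal.toReal_mul] at h1
    have hflip : ∀ e', P.real {ω | (fun t => X e' t ω) ∈ flipSet (h * k) h} ≤ h := fun e' =>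
      ENNReal.toReal_le_coe_of_le_coe ((hX.chain e').measure_flipSet_le hp _ _)
    have h2 : P.real {ω | (fun (e' : T) t => X e' t ω) ∈ B (h * k)} ≤
        P.real {ω | OpenTo G ρ m fun e => X e t₀ ω} / p + F.card * h := by
      have h3 : {ω | (fun (e' : T) t => X e' t ω) ∈ B (h * k)} =
          {ω | (fun e : T => X e (h * k) ω) ∈ openSet ρ m T} ∪
            ⋃ e' : T, {ω | (fun t => X e' t ω) ∈ flipSet (h * k) h} := by
        ext ω
        simp [B]
      rw [h3]
      refine (measureReal_union_le _ _).trans (add_le_add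
        (hX.measureReal_openSet_le hp hT hF (h * k) t₀) ?_)
      refine (measureReal_iUnion_fintype_le _).trans
        ((Finset.sum_le_sum fun (e' : T) _ => hflip e').trans ?_)
      rw [Finset.sum_const, nsmul_eq_mul, Finset.card_univ, Fintype.card_coe]
      refine mul_le_mul_of_nonneg_right ?_ h.2
      exact_mod_cast Finset.card_le_card (Finset.erase_subset e F)
    refine h1.trans_le ?_
    exact mul_le_mul (hflip e) h2 measureReal_nonneg h.2
  have h1 : P.real (flipPerc ρ X e K) ≤ P.real (⋃ k ∈ Finset.range N, I k) :=
    ENNReal.toReal_mono (measure_ne_top _ _) hcov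
  refine h1.trans ((measureReal_biUnion_finset_le _ _).trans
    ((Finset.sum_le_sum fun k _ => hIk k).trans (le_of_eq ?_)))
  have hN0 : (N : ℝ) ≠ 0 := Nat.cast_ne_zero.2 hN.ne'
  rw [Finset.sum_const, Finset.card_range, nsmul_eq_mul, ← mul_assoc, hh]
  push_cast
  rw [mul_div_cancel₀ _ hN0]

/-- Letting `N → ∞` removes the contribution of double flips; then `m → ∞` removes the rest. -/
theorem IsDynamicalPercolation.measure_flipPerc (hX : IsDynamicalPercolation G p P X)
    (hG : G.IsTree) (hfin : ∀ v, (G.neighborSet v).Finite)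
    (hp : p ∈ Ioo (0 : ℝ) 1) {t₀ : ℝ≥0}
    (hθ : Tendsto (fun m => P.real {ω | OpenTo G ρ m fun e => X e t₀ ω}) atTop (𝓝 0))
    (e : G.edgeSet) (K : ℝ≥0) : P (flipPerc ρ X e K) = 0 := by
  have h1 : ∀ m, P.real (flipPerc ρ X e K) ≤
      K * (P.real {ω | OpenTo G ρ m fun e => X e t₀ ω} / p) := by
    intro m
    obtain ⟨F, hF⟩ := exists_level_edges hG hfin ρ m
    have h2 : Tendsto (fun N : ℕ => (K : ℝ) * (P.real {ω | OpenTo G ρ m fun e => X e t₀ ω} / p +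
        F.card * (K / N))) atTop
        (𝓝 (K * (P.real {ω | OpenTo G ρ m fun e => X e t₀ ω} / p + F.card * 0))) :=
      ((tendsto_const_div_atTop_nhds_zero_nat (K : ℝ)).const_mul _ |>.const_add _).const_mul _
    rw [mul_zero, add_zero] at h2
    refine ge_of_tendsto h2 ?_
    filter_upwards [eventually_gt_atTop 0] with N hN
    exact hX.measureReal_flipPerc_le hp hF t₀ e K hN
  have h2 : P.real (flipPerc ρ X e K) ≤ 0 := by
    have h3 := (hθ.div_const p).const_mul (K : ℝ)
    rw [zero_div, mul_zero] at h3
    exact ge_of_tendsto' h3 h1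
  have h3 := le_antisymm h2 measureReal_nonneg
  rwa [measureReal_eq_zero_iff] at h3

/-- If, at every level, the root is connected to that level at some time in `D`, then there is almost
surely percolation at some time in `D`, unless there is never percolation at a fixed time. -/
theorem IsDynamicalPercolation.measure_pos_of_levels (hX : IsDynamicalPercolation G p P X)
    (hG : G.IsTree) (hfin : ∀ v, (G.neighborSet v).Finite)
    (hp : p ∈ Ioo (0 : ℝ) 1) {D : Set ℝ≥0} (hD : IsCompact D)
    (hpos : 0 < P {ω | ∀ n, ∃ t ∈ D, OpenTo G ρ n fun e => X e t ω}) :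
    0 < P {ω | ∃ t ∈ D, Percolates G ρ fun e => X e t ω} := by
  -- Under this assumption percolation at any fixed `t₀ ∈ D` has probability zero, which is what the
  -- estimate on flips requires.
  by_contra hzero
  replace hzero := le_zero_iff.1 (not_lt.1 hzero)
  choose F hF using exists_level_edges hG hfin ρ
  obtain ⟨ω₀, hω₀⟩ := nonempty_of_measure_ne_zero hpos.ne'
  obtain ⟨t₀, ht₀, -⟩ := hω₀ 0
  have hopenm : ∀ m, MeasurableSet {ω | OpenTo G ρ m fun e => X e t₀ ω} := by
    intro m
    have h1 : {ω | OpenTo G ρ m fun e => X e t₀ ω} =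
        (fun ω (e : F m) => X e t₀ ω) ⁻¹' openSet ρ m (F m) := by
      ext ω
      change (OpenTo G ρ m fun e => X e t₀ ω) ↔
        OpenTo G ρ m (fillOpen (F m) fun e => X e t₀ ω)
      refine ⟨hF m _ _ fun e he hx => ?_, hF m _ _ fun e he hx => ?_⟩
      · rwa [fillOpen, dif_pos he]
      · rwa [fillOpen, dif_pos he] at hx
    rw [h1]
    exact (measurable_pi_lambda (fun ω (e : F m) => X e t₀ ω) fun e => (hX.chain e).1 t₀) (Set.toFinite _).measurableSet
  have hθ : Tendsto (fun m => P.real {ω | OpenTo G ρ m fun e => X e t₀ ω}) atTop (𝓝 0) := by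
    have h1 := tendsto_measure_iInter_atTop (μ := P)
      (s := fun m => {ω | OpenTo G ρ m fun e => X e t₀ ω})
      (fun m => (hopenm m).nullMeasurableSet) (fun m n hmn ω (hω : OpenTo G ρ n fun e => X e t₀ ω) => hω.anti hmn)
      ⟨0, measure_ne_top _ _⟩
    have h2 : P (⋂ m, {ω | OpenTo G ρ m fun e => X e t₀ ω}) = 0 := by
      refine measure_mono_null (fun ω hω => ?_) hzero
      exact ⟨t₀, ht₀, percolates_of_forall_openTo fun m => mem_iInter.1 hω m⟩
    rw [h2] at h1
    exact (ENNReal.tendsto_toReal ENNReal.zero_ne_top).comp h1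
  obtain ⟨K, hK⟩ := hD.bddAbove
  have hnull : P (⋃ n, ⋃ e ∈ F n, flipPerc ρ X e K) = 0 :=
    measure_iUnion_null fun n => (measure_biUnion_null_iff (F n).countable_toSet).2 fun e _ =>
      hX.measure_flipPerc hG hfin hp hθ e K
  refine hpos.ne' (le_zero_iff.1 ?_)
  calc P {ω | ∀ n, ∃ t ∈ D, OpenTo G ρ n fun e => X e t ω}
      ≤ P ({ω | ∃ t ∈ D, Percolates G ρ fun e => X e t ω} ∪
          ⋃ n, ⋃ e ∈ F n, flipPerc ρ X e K) := by
        refine measure_mono_ae ?_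
        filter_upwards [hX.cadlag] with ω hω hopen
        rcases percolates_or_exists_flip hF hω hD hopen with h | ⟨n, e, he, t, htD, ht0, h⟩
        · exact Or.inl h
        · exact Or.inr (mem_iUnion.2 ⟨n, mem_biUnion he ⟨t, ht0, hK htD, h⟩⟩)
    _ ≤ _ := measure_union_le _ _
    _ = 0 := by rw [hzero, hnull, add_zero]

end LeftLimit

/-! ### Positive capacity implies percolation. -/

section Lower

variable {V Ω : Type*} [MeasurableSpace Ω] {G : SimpleGraph V} {ρ : V} {p : ℝ} {P : Measure Ω}
  [IsProbabilityMeasure P] {X : G.edgeSet → ℝ≥0 → Ω → Bool}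

/-- Moving both points by `δ` preserves the first `n` vertices and changes the time difference by at
most `2 * δ`. The base grows at most by `exp (2 * δ)`, and its power of order at most `n` by `exp 1
< 3`. -/
theorem truncKernel_le_of_dist_le (hp : p ∈ Ioo (0 : ℝ) 1) {n : ℕ} {δ : ℝ} (hδ0 : 0 ≤ δ)
    (hδ : δ ≤ Real.exp (-n)) (hδn : 2 * δ * n ≤ 1) {x y x' y' : Boundary G ρ × ℝ≥0}
    (hx : dist x' x ≤ δ) (hy : dist y' y ≤ δ) :
    truncKernel p n x' y' ≤ 3 * truncKernel p n x y := by
  have hx1 : dist x'.1 x.1 ≤ δ := (le_max_left _ _).trans hx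
  have hy1 : dist y'.1 y.1 ≤ δ := (le_max_left _ _).trans hy
  have hx2 : |(x'.2 : ℝ) - x.2| ≤ δ := by
    rw [← NNReal.dist_eq]
    exact (le_max_right _ _).trans hx
  have hy2 : |(y'.2 : ℝ) - y.2| ≤ δ := by
    rw [← NNReal.dist_eq]
    exact (le_max_right _ _).trans hy
  have hmeet : Boundary.meetUpTo n x'.1 y'.1 = Boundary.meetUpTo n x.1 y.1 :=
    Boundary.meetUpTo_congr (Boundary.dist_le_iff.1 (hx1.trans hδ))
      (Boundary.dist_le_iff.1 (hy1.trans hδ))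
  have habs : |(x.2 : ℝ) - y.2| ≤ |(x'.2 : ℝ) - y'.2| + 2 * δ := by
    have h1 : (x.2 : ℝ) - y.2 = (x'.2 - y'.2) - (x'.2 - x.2) + (y'.2 - y.2) := by ring
    rw [h1]
    refine (abs_add_le _ _).trans ?_
    have := abs_sub ((x'.2 : ℝ) - y'.2) (x'.2 - x.2)
    linarith
  have hbase : openRatio p x'.2 y'.2 ≤ Real.exp (2 * δ) * openRatio p x.2 y.2 := by
    have h1 : 1 ≤ Real.exp (2 * δ) := Real.one_le_exp (by linarith)
    have h2 : Real.exp (-|(x'.2 : ℝ) - y'.2|) ≤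
        Real.exp (2 * δ) * Real.exp (-|(x.2 : ℝ) - y.2|) := by
      rw [← Real.exp_add]
      exact Real.exp_le_exp.2 (by linarith)
    have h3 : 0 ≤ (1 - p) / p := (div_pos (sub_pos.2 hp.2) hp.1).le
    rw [openRatio, openRatio]
    nlinarith [mul_le_mul_of_nonneg_left h2 h3]
  have hpos : ∀ s t, 0 ≤ openRatio p s t := fun s t => zero_le_one.trans (one_lt_openRatio hp s t).le
  have hk : Boundary.meetUpTo n x.1 y.1 ≤ n := (Boundary.le_meetUpTo_iff.1 le_rfl).1
  rw [truncKernel, truncKernel, hmeet]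
  refine (pow_le_pow_left₀ (hpos _ _) hbase _).trans ?_
  rw [mul_pow]
  refine mul_le_mul_of_nonneg_right ?_ (pow_nonneg (hpos _ _) _)
  rw [← Real.exp_nat_mul]
  refine le_trans (Real.exp_le_exp.2 ?_) Real.exp_one_lt_three.le
  have : (Boundary.meetUpTo n x.1 y.1 : ℝ) ≤ n := Nat.cast_le.2 hk
  nlinarith

/-- A compact set is, up to `δ`, the range of a simple function with values in the set. -/
theorem exists_simpleFunc_near {K : Type*} [MetricSpace K] [MeasurableSpace K]
    [OpensMeasurableSpace K] {S : Set K} (hS : IsCompact S) (hne : S.Nonempty) {δ : ℝ}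
    (hδ : 0 < δ) : ∃ φ : SimpleFunc K K, (∀ x, φ x ∈ S) ∧ ∀ x ∈ S, dist (φ x) x ≤ δ := by
  obtain ⟨T, hTS, hT, hcov⟩ := hS.finite_cover_balls hδ
  have hTne : T.Nonempty := by
    obtain ⟨x, hx⟩ := hne
    obtain ⟨y, hy, -⟩ := mem_iUnion₂.1 (hcov hx)
    exact ⟨y, hy⟩
  obtain ⟨e, rfl⟩ := hT.countable.exists_eq_range hTne
  obtain ⟨M, hM⟩ : ∃ M, ∀ y ∈ range e, ∃ k ≤ M, e k = y := by
    choose! g hg using fun y (hy : y ∈ range e) => hy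
    obtain ⟨M, hM⟩ := (hT.image g).bddAbove
    exact ⟨M, fun y hy => ⟨g y, hM (mem_image_of_mem g hy), hg y hy⟩⟩
  refine ⟨SimpleFunc.nearestPt e M, fun x => hTS ⟨SimpleFunc.nearestPtInd e M x, rfl⟩,
    fun x hx => ?_⟩
  obtain ⟨y, hy, hxy⟩ := mem_iUnion₂.1 (hcov hx)
  obtain ⟨k, hk, rfl⟩ := hM y hy
  have h1 := SimpleFunc.edist_nearestPt_le e x hk
  rw [edist_dist, edist_dist, ENNReal.ofReal_le_ofReal_iff dist_nonneg] at h1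
  refine h1.trans ?_
  rw [dist_comm]
  exact (Metric.mem_ball.1 hxy).le

/-- The measure `μ` is pushed forward by a simple function that moves almost every point by at most
`δ` and takes values in `∂G × D`; this increases the truncated energy at most threefold. -/
theorem exists_finite_weights (hG : G.IsTree) (hfin : ∀ v, (G.neighborSet v).Finite)
    (hp : p ∈ Ioo (0 : ℝ) 1) {D : Set ℝ≥0} (hD : IsCompact D) {μ : Measure (Boundary G ρ × ℝ≥0)}
    [IsProbabilityMeasure μ] (hμ : μ (univ ×ˢ D)ᶜ = 0) (hen : energy (kernelH p) μ ≠ ⊤) (n : ℕ) :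
    ∃ (N : ℕ) (ray : Fin N → Boundary G ρ) (m : ℕ) (t : Fin (m + 1) → ℝ≥0)
      (a : Fin N → Fin (m + 1) → ℝ), Monotone t ∧ (∀ j, t j ∈ D) ∧ ∑ i, ∑ j, a i j = 1 ∧
      ∑ i, ∑ j, ∑ w, ∑ s, a i j * a w s * truncKernel p n (ray i, t j) (ray w, t s) ≤
        3 * (energy (kernelH p) μ).toReal := by
  classical
  have := Boundary.compactSpace (ρ := ρ) hG hfin
  set S : Set (Boundary G ρ × ℝ≥0) := univ ×ˢ D with hS
  have hSne : S.Nonempty := by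
    by_contra hne
    rw [not_nonempty_iff_eq_empty] at hne
    rw [hne, compl_empty, measure_univ] at hμ
    exact one_ne_zero hμ
  -- The first bound preserves the first `n` vertices, the second the power of the base; `n + 1`
  -- avoids division by zero.
  set δ : ℝ := min (Real.exp (-n)) (1 / (2 * (n + 1))) with hδ
  have hn0 : (0 : ℝ) < 2 * (n + 1) := by positivity
  have hδ0 : 0 < δ := lt_min (Real.exp_pos _) (one_div_pos.2 hn0)
  have hδn : 2 * δ * n ≤ 1 := by
    have h1 : δ ≤ 1 / (2 * (n + 1)) := min_le_right _ _
    rw [le_div_iff₀ hn0] at h1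
    nlinarith
  obtain ⟨φ, hφS, hφ⟩ := exists_simpleFunc_near (isCompact_univ.prod hD) hSne hδ0
  have hSae : ∀ᵐ x ∂μ, x ∈ S := by
    rw [ae_iff]
    exact hμ
  set R := φ.range with hR
  let x : Fin R.card → Boundary G ρ × ℝ≥0 := fun i => (R.equivFin.symm i).1
  have hsum : ∀ g : Boundary G ρ × ℝ≥0 → ℝ≥0∞,
      ∫⁻ y, g (φ y) ∂μ = ∑ i, g (x i) * μ (φ ⁻¹' {x i}) := by
    intro g
    have h1 := SimpleFunc.map_lintegral (μ := μ) g φ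
    rw [← SimpleFunc.lintegral_eq_lintegral] at h1
    refine h1.trans ?_
    rw [← Finset.sum_coe_sort]
    exact (Equiv.sum_comp R.equivFin.symm
      fun c : R => g c * μ (φ ⁻¹' {(c : Boundary G ρ × ℝ≥0)})).symm
  let w : Fin R.card → ℝ := fun i => μ.real (φ ⁻¹' {x i})
  have hw : ∀ i, μ (φ ⁻¹' {x i}) = ENNReal.ofReal (w i) := fun i =>
    (ENNReal.ofReal_toReal (measure_ne_top _ _)).symm
  have hw0 : ∀ i, 0 ≤ w i := fun i => measureReal_nonneg
  have hw1 : ∑ i, w i = 1 := by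
    have h1 := hsum fun _ => 1
    simp only [lintegral_const, measure_univ, mul_one, one_mul, hw] at h1
    rw [← ENNReal.ofReal_sum_of_nonneg fun i _ => hw0 i] at h1
    have h2 := congrArg ENNReal.toReal h1
    rw [ENNReal.toReal_ofReal (Finset.sum_nonneg fun i _ => hw0 i), ENNReal.toReal_one] at h2
    exact h2.symm
  have hkpos : ∀ i j, 0 ≤ w i * w j * truncKernel p n (x i) (x j) := fun i j =>
    mul_nonneg (mul_nonneg (hw0 i) (hw0 j)) (truncKernel_pos hp _ _ _).le
  have hE : ∑ i, ∑ j, w i * w j * truncKernel p n (x i) (x j) ≤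
      3 * (energy (kernelH p) μ).toReal := by
    have h1 : ∫⁻ u, ∫⁻ v, ENNReal.ofReal (truncKernel p n (φ u) (φ v)) ∂μ ∂μ =
        ENNReal.ofReal (∑ i, ∑ j, w i * w j * truncKernel p n (x i) (x j)) := by
      have h2 : ∀ u, ∫⁻ v, ENNReal.ofReal (truncKernel p n u (φ v)) ∂μ =
          ∑ j, ENNReal.ofReal (truncKernel p n u (x j)) * ENNReal.ofReal (w j) := fun u => by
        rw [hsum fun c => ENNReal.ofReal (truncKernel p n u c)]
        simp only [hw]
      simp only [h2]
      rw [hsum fun c => ∑ j, ENNReal.ofReal (truncKernel p n c (x j)) * ENNReal.ofReal (w j),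
        ENNReal.ofReal_sum_of_nonneg fun i _ => Finset.sum_nonneg fun j _ => hkpos i j]
      refine Finset.sum_congr rfl fun i _ => ?_
      rw [ENNReal.ofReal_sum_of_nonneg fun j _ => hkpos i j, hw, Finset.sum_mul]
      refine Finset.sum_congr rfl fun j _ => ?_
      rw [ENNReal.ofReal_mul (mul_nonneg (hw0 i) (hw0 j)), ENNReal.ofReal_mul (hw0 i)]
      ring
    have h3 : ∫⁻ u, ∫⁻ v, ENNReal.ofReal (truncKernel p n (φ u) (φ v)) ∂μ ∂μ ≤
        3 * energy (kernelH p) μ := by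
      rw [energy, ← lintegral_const_mul' _ _ (by norm_num)]
      refine lintegral_mono_ae ?_
      filter_upwards [hSae] with u hu
      rw [← lintegral_const_mul' _ _ (by norm_num)]
      refine lintegral_mono_ae ?_
      filter_upwards [hSae] with v hv
      rw [kernelH_eq_iSup hp]
      refine le_trans ?_ (mul_le_mul_right (le_iSup _ n) _)
      have h4 : (3 : ℝ≥0∞) = ENNReal.ofReal 3 := by norm_num
      rw [h4, ← ENNReal.ofReal_mul (by norm_num)]
      exact ENNReal.ofReal_le_ofReal
        (truncKernel_le_of_dist_le hp hδ0.le (min_le_left _ _) hδn (hφ u hu) (hφ v hv))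
    rw [h1] at h3
    have h5 := ENNReal.toReal_mono (ENNReal.mul_ne_top (by norm_num) hen) h3
    rwa [ENNReal.toReal_ofReal (Finset.sum_nonneg fun i _ => Finset.sum_nonneg fun j _ =>
      hkpos i j), ENNReal.toReal_mul, ENNReal.toReal_ofNat] at h5
  have hne : (R.image Prod.snd).Nonempty := by
    obtain ⟨z, -⟩ := hSne
    exact ⟨(φ z).2, Finset.mem_image_of_mem _ (SimpleFunc.mem_range_self φ z)⟩
  obtain ⟨m, t, htm, ht⟩ := exists_monotone_enumeration _ hne
  have hj : ∀ i, ∃ j, t j = (x i).2 := fun i =>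
    (ht _).1 (Finset.mem_image_of_mem _ (R.equivFin.symm i).2)
  choose j hj using hj
  -- Each value of `φ` gets its own index `i`, even if rays repeat, and its weight sits at the index
  -- of its own time.
  refine ⟨R.card, fun i => (x i).1, m, t, fun i k => if k = j i then w i else 0, htm, fun k => ?_,
    ?_, ?_⟩
  · obtain ⟨c, hc, hck⟩ := Finset.mem_image.1 ((ht (t k)).2 ⟨k, rfl⟩)
    obtain ⟨z, rfl⟩ := SimpleFunc.mem_range.1 hc
    rw [← hck]
    exact (hφS z).2
  · simpa using hw1
  · refine le_trans (le_of_eq ?_) hE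
    refine Finset.sum_congr rfl fun i _ => ?_
    rw [Finset.sum_eq_single (j i) (fun k _ hk => by simp [hk]) (by simp)]
    refine Finset.sum_congr rfl fun i' _ => ?_
    rw [Finset.sum_eq_single (j i') (fun k _ hk => by simp [hk]) (by simp)]
    simp only [if_true, hj]

/-- If the events `A n` have probability at least `c`, so does the event that infinitely many of them
occur. -/
theorem le_measure_iInter_iUnion {A : ℕ → Set Ω} (hA : ∀ n, MeasurableSet (A n)) {c : ℝ≥0∞}
    (hc : ∀ n, c ≤ P (A n)) : c ≤ P (⋂ n, ⋃ m ≥ n, A m) := by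
  have h1 := tendsto_measure_iInter_atTop (μ := P) (s := fun n => ⋃ m ≥ n, A m)
    (fun n => (MeasurableSet.biUnion (Set.to_countable _) fun m _ => hA m).nullMeasurableSet)
    (fun n n' hnn => biUnion_subset_biUnion_left fun m hm => le_trans hnn hm)
    ⟨0, measure_ne_top _ _⟩
  refine ge_of_tendsto' h1 fun n => (hc n).trans (measure_mono ?_)
  exact subset_biUnion_of_mem (u := A) (le_refl n)

/-- If some probability measure on `∂G × D` has finite energy, then percolation occurs at some time
in `D` with positive probability. -/
theorem IsDynamicalPercolation.measure_pos_of_capacity (hX : IsDynamicalPercolation G p P X)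
    (hG : G.IsTree) (hfin : ∀ v, (G.neighborSet v).Finite) (hp : p ∈ Ioo (0 : ℝ) 1)
    {D : Set ℝ≥0} (hD : IsCompact D)
    (hcap : 0 < capacity (kernelH (G := G) (ρ := ρ) p) (univ ×ˢ D)) :
    0 < P {ω | ∃ t ∈ D, Percolates G ρ fun e => X e t ω} := by
  rw [capacity, ENNReal.inv_pos, ← lt_top_iff_ne_top, iInf_lt_iff] at hcap
  obtain ⟨μ, hcap⟩ := hcap
  obtain ⟨hμ1, hcap⟩ := iInf_lt_iff.1 hcap
  obtain ⟨hμ, hcap⟩ := iInf_lt_iff.1 hcap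
  set E : ℝ := 3 * (energy (kernelH p) μ).toReal with hE
  choose N ray m t a htm htD ha haE using
    fun n => exists_finite_weights hG hfin hp hD hμ hcap.ne n
  let A : ℕ → Set Ω := fun n =>
    {ω | ∃ i j, ∀ k < n, X ((ray n i).edge k) (t n j) ω = true}
  have hAm : ∀ n, MeasurableSet (A n) := by
    intro n
    have h1 : A n = ⋃ i, ⋃ j, ⋂ k, ⋂ (_ : k < n), {ω | X ((ray n i).edge k) (t n j) ω = true} := by
      ext ω
      simp [A]
    rw [h1]
    exact MeasurableSet.iUnion fun i => MeasurableSet.iUnion fun j => MeasurableSet.iInter fun k =>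
      MeasurableSet.iInter fun _ => (hX.chain _).1 _ (measurableSet_singleton true)
  have hAE : ∀ n, 1 ≤ P.real (A n) * E := fun n =>
    ((hX.energy_bounds hG hp (htm n) n (ray n)).1 (a n) (ha n)).trans
      (mul_le_mul_of_nonneg_left (haE n) measureReal_nonneg)
  have hE0 : 0 < E := by
    by_contra hle
    have h1 := hAE 0
    have h2 : P.real (A 0) * E ≤ 0 :=
      mul_nonpos_of_nonneg_of_nonpos measureReal_nonneg (not_lt.1 hle)
    linarith
  have hPA : ∀ n, ENNReal.ofReal (1 / E) ≤ P (A n) := by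
    intro n
    rw [← ENNReal.ofReal_toReal (measure_ne_top P (A n))]
    exact ENNReal.ofReal_le_ofReal ((div_le_iff₀ hE0).2 (hAE n))
  -- The events `A n` come from unrelated discretizations and are not nested, so infinitely many of
  -- them are required; reaching a higher level implies reaching level `n`.
  refine hX.measure_pos_of_levels hG hfin hp hD ?_
  refine (ENNReal.ofReal_pos.2 (one_div_pos.2 hE0)).trans_le
    ((le_measure_iInter_iUnion hAm hPA).trans (measure_mono fun ω hω n => ?_))
  obtain ⟨m', hm', i, j, hij⟩ := mem_iUnion₂.1 (mem_iInter.1 hω n)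
  exact ⟨t m' j, htD m' j, OpenTo.anti hm' ⟨ray m' i, hij⟩⟩

end Lower

end DynPerc

theorem mainTheorem2 {V : Type*} (G : SimpleGraph V) (hG : G.IsTree)
    (hfin : ∀ v, (G.neighborSet v).Finite) (ρ : V)
    (p : ℝ) (hp : p ∈ Set.Ioo (0 : ℝ) 1)
    {Ω : Type*} [MeasurableSpace Ω] (P : Measure Ω) [IsProbabilityMeasure P]
    (X : G.edgeSet → ℝ≥0 → Ω → Bool) (hX : DynPerc.IsDynamicalPercolation G p P X)
    (D : Set ℝ≥0) (hD : IsCompact D) :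
    0 < P {ω | ∃ t ∈ D, DynPerc.Percolates G ρ (fun e => X e t ω)} ↔
      0 < DynPerc.capacity (DynPerc.kernelH (G := G) (ρ := ρ) p) (Set.univ ×ˢ D) :=
  ⟨hX.capacity_pos hG hfin hp hD, hX.measure_pos_of_capacity hG hfin hp hD⟩
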